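/- Fix $d\ge 0$. Let $D^p=[-1,1]^p$, included in $D^{p+1}$ by $x\mapsto(x,0)$. Let $\psi_d(D^p)$ be the set of subsets $W\subseteq D^p$ that are closed, disjoint from $\partial D^p$, and smooth $d$-dimensional submanifolds without boundary. A map $f:\mathbb R^n\to\psi_d(D^p)$ ($n\ge 0$) is a plot if its graph $\{(u,x): x\in f(u)\}$ is a smooth submanifold of $\mathbb R^n\times D^p$, closed as a subset, whose projection to $\mathbb R^n$ is a submersion; $\psi_d(D^p)$ carries the finest topology making all plots continuous. Put $\psi_d(D^\infty)=\operatorname{colim}_p\psi_d(D^p)$. For a compact (Hausdorff, smooth, boundaryless, possibly empty or disconnected) $d$-manifold $M$ let $\psi_d^M(D^\infty)\subseteq\psi_d(D^\infty)$ be the subspace of those $W$ which are diffeomorphic to $M$. Let $Emb(M,D^p)$ be the set of smooth embeddings $M\to D^p$ disjoint from $\partial D^p$, with the finest topology making all plots continuous, a plot being a smooth embedding $\mathbb R^n\times M\to\mathbb R^n\times D^p$ over $\mathbb R^n$ with image disjoint from $\mathbb R^n\times\partial D^p$; put $Emb(M,D^\infty)=\operatorname{colim}_pEmb(M,D^p)$.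 Topologize $Diff(M)$ likewise, the plots being the diffeomorphisms of $\mathbb R^n\times M$ over $\mathbb R^n$. Then: 1. $\psi_d(D^\infty)=\coprod_{[M]}\psi_d^M(D^\infty)$ as topological spaces, where $[M]$ runs over the diffeomorphism types of compact $d$-manifolds. 2. For every compact $d$-manifold $M$, the map $Emb(M,D^\infty)\to\psi_d^M(D^\infty)$, $\varphi\mapsto\varphi(M)$, with the action of $Diff(M)$ by precomposition, is a locally trivial principal $Diff(M)$-bundle in the category of $\Delta$-generated spaces (that is, all products, such as in the multiplication of $Diff(M)$, the action and the local trivializations, carry the $\Delta$-generated product topology). 3. $Emb(M,D^\infty)$ is contractible. Hence $\psi_d^M(D^\infty)$ is a model for the classifying space $BDiff(M)$, i.e. the base of a principal $Diff(M)$-bundle with contractible total space. -/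

import Mathlib

open scoped Manifold ContDiff Topology

noncomputable section

namespace SubmanifoldSpace

/-! ### Plot topologies and products of Delta-generated spaces -/

/-- The Euclidean space `ℝⁿ`. -/
abbrev Euc (n : ℕ) : Type := EuclideanSpace ℝ (Fin n)

/-- The plot topology of a collection of plots: the finest topology making all plots continuous.
The sources of the plots are the manifolds `ℝⁿ`, `n ≥ 0`; as every manifold is covered by open
subsets diffeomorphic to `ℝⁿ`, and openness is a local condition, plots indexed by arbitrary smooth
manifolds give the same topology. -/
@[reducible] def plotTopology {X : Type*} (IsPlot : ∀ n : ℕ, (Euc n → X) → Prop) : TopologicalSpace X :=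
  ⨆ (n : ℕ) (f : {f : Euc n → X // IsPlot n f}), TopologicalSpace.coinduced f.1 inferInstance

theorem isOpen_plotTopology_iff {X : Type*} (IsPlot : ∀ n : ℕ, (Euc n → X) → Prop) (A : Set X) :
    IsOpen[plotTopology IsPlot] A ↔ ∀ (n : ℕ) (f : Euc n → X), IsPlot n f → IsOpen (f ⁻¹' A) := by
  unfold plotTopology
  simp only [isOpen_iSup_iff, isOpen_coinduced, Subtype.forall]

/-- The product in the category of Delta-generated spaces: the product set with the topology
coinduced by all continuous maps `ℝⁿ → X × Y`. -/
abbrev DeltaProd (X Y : Type*) [TopologicalSpace X] [TopologicalSpace Y] : Type _ :=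
  Topology.WithGeneratedByTopology (fun n : ℕ ↦ (Fin n → ℝ)) (X × Y)

/-- The underlying pair of a point of `DeltaProd X Y`. -/
abbrev DeltaProd.pair {X Y : Type*} [TopologicalSpace X] [TopologicalSpace Y]
    (z : DeltaProd X Y) : X × Y :=
  Topology.WithGeneratedByTopology.equiv z

/-- Group objects in Delta-generated spaces. -/
structure IsDeltaGroup (G : Type*) [Group G] [TopologicalSpace G] : Prop where
  deltaGenerated : DeltaGeneratedSpace G
  continuous_mul : Continuous fun z : DeltaProd G G ↦ z.pair.1 * z.pair.2
  continuous_inv : Continuous fun g : G ↦ g⁻¹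

/-- `π : E → B`, with the right action `act` of `G` on `E`, is a (locally trivial) principal
`G`-bundle in Delta-generated spaces. -/
structure IsPrincipalBundle {G E B : Type*} [Group G] [TopologicalSpace G] [TopologicalSpace E]
    [TopologicalSpace B] (act : E → G → E) (π : E → B) : Prop where
  group : IsDeltaGroup G
  deltaGenerated_total : DeltaGeneratedSpace E
  deltaGenerated_base : DeltaGeneratedSpace B
  act_one : ∀ e : E, act e 1 = e
  act_mul : ∀ (e : E) (g h : G), act e (g * h) = act (act e g) h
  continuous_act : Continuous fun z : DeltaProd E G ↦ act z.pair.1 z.pair.2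
  continuous_proj : Continuous π
  proj_act : ∀ (e : E) (g : G), π (act e g) = π e
  locally_trivial : ∀ b : B, ∃ V : Set B, IsOpen V ∧ b ∈ V ∧
    ∃ h : (π ⁻¹' V) ≃ₜ DeltaProd V G,
      (∀ e, ((h e).pair.1 : B) = π e) ∧
      ∀ (e e' : π ⁻¹' V) (g : G), (e' : E) = act e g → (h e').pair.2 = (h e).pair.2 * g

/-- `B` is a model for the classifying space of `G`: the base of a principal `G`-bundle with
contractible total space. -/
def IsClassifyingSpace.{u, v} (G : Type u) [Group G] [TopologicalSpace G]
    (B : Type v) [TopologicalSpace B] : Prop :=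
  ∃ (E : Type u) (_ : TopologicalSpace E) (act : E → G → E) (π : E → B),
    IsPrincipalBundle act π ∧ ContractibleSpace E

/-! ### Compact manifolds and their diffeomorphism groups -/

/-- Smooth compact Hausdorff `d`-manifolds without boundary, possibly empty or disconnected. -/
structure CompactManifold (d : ℕ) : Type 1 where
  carrier : Type
  [top : TopologicalSpace carrier]
  [charted : ChartedSpace (Euc d) carrier]
  [smooth : IsManifold (𝓡 d) ∞ carrier]
  [compact : CompactSpace carrier]
  [t2 : T2Space carrier]

instance (d : ℕ) : CoeSort (CompactManifold d) Type := ⟨CompactManifold.carrier⟩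

attribute [instance] CompactManifold.top CompactManifold.charted CompactManifold.smooth
  CompactManifold.compact CompactManifold.t2

instance diffeoSetoid (d : ℕ) : Setoid (CompactManifold d) where
  r M N := Nonempty (M ≃ₘ^∞⟮𝓡 d, 𝓡 d⟯ N)
  iseqv :=
    { refl := fun M ↦ ⟨Diffeomorph.refl (𝓡 d) M ∞⟩
      symm := fun ⟨f⟩ ↦ ⟨f.symm⟩
      trans := fun ⟨f⟩ ⟨g⟩ ↦ ⟨f.trans g⟩ }

/-- The set of diffeomorphism types of compact `d`-manifolds. -/
abbrev DiffeoType (d : ℕ) : Type 1 := Quotient (diffeoSetoid d)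

variable {d : ℕ}

/-- The diffeomorphism group of `M`. -/
def Diff (M : CompactManifold d) : Type := M ≃ₘ^∞⟮𝓡 d, 𝓡 d⟯ M

namespace Diff

/-- The underlying diffeomorphism. -/
def toDiffeo {M : CompactManifold d} (g : Diff M) : M ≃ₘ^∞⟮𝓡 d, 𝓡 d⟯ M := g

/-- The product `g * h` is the composite `g ∘ h`. -/
instance (M : CompactManifold d) : Group (Diff M) where
  mul g h := Diffeomorph.trans h.toDiffeo g.toDiffeo
  one := Diffeomorph.refl (𝓡 d) M ∞
  inv g := Diffeomorph.symm g.toDiffeo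
  mul_assoc _ _ _ := rfl
  one_mul _ := rfl
  mul_one _ := rfl
  inv_mul_cancel g := Diffeomorph.ext fun x ↦ g.toDiffeo.symm_apply_apply x

/-- A plot of `Diff M` is a diffeomorphism `(u, m) ↦ (u, g u m)` of `ℝⁿ × M` over `ℝⁿ`. -/
def IsPlot (M : CompactManifold d) (n : ℕ) (g : Euc n → Diff M) : Prop :=
  ContMDiff ((𝓡 n).prod (𝓡 d)) (𝓡 d) ∞ (fun z : Euc n × M ↦ (g z.1).toDiffeo z.2) ∧
  ContMDiff ((𝓡 n).prod (𝓡 d)) (𝓡 d) ∞ (fun z : Euc n × M ↦ (g z.1).toDiffeo.symm z.2)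

instance (M : CompactManifold d) : TopologicalSpace (Diff M) := plotTopology (Diff.IsPlot M)

end Diff

/-! ### Cubes and their stabilization -/

/-- The interior `{x | |xᵢ| < 1}` of the cube `Dᵖ = {x | |xᵢ| ≤ 1} ⊆ ℝᵖ`. -/
def openCube (p : ℕ) : Set (Euc p) := {x | ∀ i, |x i| < 1}

/-- The inclusion `ℝᵖ → ℝ^∞`, `x ↦ (x₁, …, x_p, 0, 0, …)`. -/
def stab (p : ℕ) (x : Euc p) : ℕ →₀ ℝ :=
  Finsupp.embDomain Fin.valEmbedding (Finsupp.equivFunOnFinite.symm fun i ↦ x i)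

/-! ### Submanifolds -/

section Submanifolds

variable {E : Type*} [NormedAddCommGroup E] [NormedSpace ℝ E]

/-- `Φ` is a smooth chart of `E` which flattens `W` to the linear subspace `L`. -/
structure IsSliceChart (W : Set E) (L : Submodule ℝ E) (Φ : OpenPartialHomeomorph E E) : Prop where
  contDiffOn : ContDiffOn ℝ ∞ Φ Φ.source
  contDiffOn_symm : ContDiffOn ℝ ∞ Φ.symm Φ.target
  mem_iff : ∀ y ∈ Φ.source, Φ y ∈ L ↔ y ∈ W

/-- `W` is a smooth embedded `k`-dimensional submanifold (without boundary) of `E`. -/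
def IsSubmanifold (k : ℕ) (W : Set E) : Prop :=
  ∀ x ∈ W, ∃ (L : Submodule ℝ E) (Φ : OpenPartialHomeomorph E E),
    x ∈ Φ.source ∧ Module.finrank ℝ L = k ∧ IsSliceChart W L Φ

/-- The vectors tangent at `x` to the submanifold `W`. -/
def tangentVectors (W : Set E) (x : E) : Set E :=
  {v | ∃ (L : Submodule ℝ E) (Φ : OpenPartialHomeomorph E E),
    x ∈ Φ.source ∧ IsSliceChart W L Φ ∧ fderiv ℝ Φ x v ∈ L}

/-- The submanifold `W` of `E` is diffeomorphic to `M`: there is a bijection `M → W` which is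
smooth as a map to `E` and whose inverse extends, locally around each point of `W`, to a smooth map
on an open subset of `E`. -/
def IsDiffeomorphicTo (M : CompactManifold d) (W : Set E) : Prop :=
  ∃ e : M ≃ W, ContMDiff (𝓡 d) 𝓘(ℝ, E) ∞ (fun m ↦ (e m : E)) ∧
    ∀ y : W, ∃ (O : Set E) (r : E → M), IsOpen O ∧ (y : E) ∈ O ∧
      ContMDiffOn 𝓘(ℝ, E) (𝓡 d) ∞ r O ∧ ∀ z : W, (z : E) ∈ O → r z = e.symm z

/-- Smooth embeddings of a manifold in `E`. -/
structure IsSmoothEmb {F H N : Type*} [NormedAddCommGroup F] [NormedSpace ℝ F] [TopologicalSpace H]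
    [TopologicalSpace N] [ChartedSpace H N] (I : ModelWithCorners ℝ F H) (f : N → E) : Prop where
  contMDiff : ContMDiff I 𝓘(ℝ, E) ∞ f
  isEmbedding : Topology.IsEmbedding f
  injective_mfderiv : ∀ x : N, Function.Injective (mfderiv I 𝓘(ℝ, E) f x)

end Submanifolds

/-! ### The spaces `ψ_d(Dᵖ)` and `ψ_d(D^∞)` -/

/-- The set `ψ_d(Dᵖ)` of smooth `d`-dimensional submanifolds without boundary of `Dᵖ` which are
closed subsets and disjoint from the boundary of `Dᵖ`. -/
def Psi (d p : ℕ) : Type :=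
  {W : Set (Euc p) // IsClosed W ∧ W ⊆ openCube p ∧ IsSubmanifold d W}

/-- The graph of a family of submanifolds. -/
def Psi.graph {p n : ℕ} (f : Euc n → Psi d p) : Set (Euc n × Euc p) :=
  {z | z.2 ∈ (f z.1).1}

/-- A plot of `ψ_d(Dᵖ)` is a family whose graph is a closed smooth submanifold of `ℝⁿ × Dᵖ`
such that the projection of the graph to `ℝⁿ` is a submersion. -/
structure Psi.IsPlot (d p n : ℕ) (f : Euc n → Psi d p) : Prop where
  isClosed_graph : IsClosed (Psi.graph f)
  isSubmanifold_graph : IsSubmanifold (n + d) (Psi.graph f)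
  submersion : ∀ z ∈ Psi.graph f, ∀ u : Euc n, ∃ v ∈ tangentVectors (Psi.graph f) z, v.1 = u

instance (d p : ℕ) : TopologicalSpace (Psi d p) := plotTopology (Psi.IsPlot d p)

/-- The underlying set of the colimit `ψ_d(D^∞)` of the spaces `ψ_d(Dᵖ)` along the inclusions
`Dᵖ ⊆ Dᵖ⁺¹`, `x ↦ (x, 0)`: the elements of all `ψ_d(Dᵖ)`, viewed as subsets of `ℝ^∞`. -/
def PsiInf (d : ℕ) : Type :=
  {W : Set (ℕ →₀ ℝ) // ∃ (p : ℕ) (V : Psi d p), stab p '' V.1 = W}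

/-- The canonical map `ψ_d(Dᵖ) → ψ_d(D^∞)`. -/
def PsiInf.incl (d p : ℕ) (V : Psi d p) : PsiInf d := ⟨stab p '' V.1, p, V, rfl⟩

/-- The colimit topology. -/
instance (d : ℕ) : TopologicalSpace (PsiInf d) :=
  ⨆ p : ℕ, TopologicalSpace.coinduced (PsiInf.incl d p) inferInstance

/-- The subspace `ψ_d^M(D^∞)` of the submanifolds which are diffeomorphic to `M`. -/
def PsiInfOf (M : CompactManifold d) : Type :=
  {W : PsiInf d // ∃ (p : ℕ) (V : Psi d p), PsiInf.incl d p V = W ∧ IsDiffeomorphicTo M V.1}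

instance (M : CompactManifold d) : TopologicalSpace (PsiInfOf M) :=
  inferInstanceAs (TopologicalSpace {W : PsiInf d //
    ∃ (p : ℕ) (V : Psi d p), PsiInf.incl d p V = W ∧ IsDiffeomorphicTo M V.1})

/-! ### The spaces `Emb(M, Dᵖ)` and `Emb(M, D^∞)` -/

/-- The set `Emb(M, Dᵖ)` of smooth embeddings of `M` in `Dᵖ` disjoint from the boundary. -/
def Emb (M : CompactManifold d) (p : ℕ) : Type :=
  {f : M → Euc p // IsSmoothEmb (𝓡 d) f ∧ ∀ m, f m ∈ openCube p}

/-- A plot of `Emb(M, Dᵖ)` is an embedding `ℝⁿ × M → ℝⁿ × Dᵖ` over `ℝⁿ`. -/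
def Emb.IsPlot (M : CompactManifold d) (p n : ℕ) (f : Euc n → Emb M p) : Prop :=
  IsSmoothEmb ((𝓡 n).prod (𝓡 d)) (fun z : Euc n × M ↦ (z.1, (f z.1).1 z.2))

instance (M : CompactManifold d) (p : ℕ) : TopologicalSpace (Emb M p) :=
  plotTopology (Emb.IsPlot M p)

/-- The underlying set of the colimit `Emb(M, D^∞)` of the spaces `Emb(M, Dᵖ)`. -/
def EmbInf (M : CompactManifold d) : Type :=
  {f : M → (ℕ →₀ ℝ) // ∃ (p : ℕ) (φ : Emb M p), (fun m ↦ stab p (φ.1 m)) = f}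

/-- The canonical map `Emb(M, Dᵖ) → Emb(M, D^∞)`. -/
def EmbInf.incl (M : CompactManifold d) (p : ℕ) (φ : Emb M p) : EmbInf M :=
  ⟨fun m ↦ stab p (φ.1 m), p, φ, rfl⟩

/-- The colimit topology. -/
instance (M : CompactManifold d) : TopologicalSpace (EmbInf M) :=
  ⨆ p : ℕ, TopologicalSpace.coinduced (EmbInf.incl M p) inferInstance

theorem IsSmoothEmb.comp_diffeo {E : Type*} [NormedAddCommGroup E] [NormedSpace ℝ E]
    {M : CompactManifold d} {f : M → E} (hf : IsSmoothEmb (𝓡 d) f) (g : M ≃ₘ^∞⟮𝓡 d, 𝓡 d⟯ M) :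
    IsSmoothEmb (𝓡 d) (fun m ↦ f (g m)) where
  contMDiff := hf.contMDiff.comp g.contMDiff
  isEmbedding := hf.isEmbedding.comp g.toHomeomorph.isEmbedding
  injective_mfderiv x := by
    have h := mfderiv_comp x ((hf.contMDiff (g x)).mdifferentiableAt (by simp))
      ((g.contMDiff x).mdifferentiableAt (by simp))
    have h2 : Function.Injective (mfderiv (𝓡 d) (𝓡 d) g x) :=
      (g.mfderivToContinuousLinearEquiv (by simp) x).injective
    rw [show (fun m ↦ f (g m)) = f ∘ g from rfl, h]
    exact (hf.injective_mfderiv (g x)).comp h2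

/-- The right action of `Diff M` on `Emb(M, D^∞)` by precomposition. -/
def EmbInf.act {M : CompactManifold d} (φ : EmbInf M) (g : Diff M) : EmbInf M :=
  ⟨fun m ↦ φ.1 (g.toDiffeo m), by
    obtain ⟨f, p, ψ, rfl⟩ := φ
    exact ⟨p, ⟨fun m ↦ ψ.1 (g.toDiffeo m), ψ.2.1.comp_diffeo g.toDiffeo, fun m ↦ ψ.2.2 _⟩, rfl⟩⟩

end SubmanifoldSpace

end

noncomputable section

/-! Every space here carries the finest topology for a class of plots, and a plot of a colimit
factors through a finite stage. Continuity and openness can therefore be tested along smooth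
finite-dimensional families, where they become statements about compact manifolds and the inverse
function theorem.

For the bundle, fix an embedding `φ₀` of a nonempty `M` in `Dᵖ` and a smooth retraction `r : O → M`
of a neighbourhood of its image (`IsSmoothEmb.exists_retraction`). Call an embedding `φ` in `D^∞`
normalized if `r ∘ trunc p ∘ φ = id`. A submanifold has at most one normalized parametrization
(`IsNormalized.unique`); let `V` be the set of submanifolds that have one. Along a plot, solving `r
(trunc p x) = m` for `x` in the moving submanifold is an inverse function problem near each point,
and compactness of the cube and of `M` makes the solutions exist, be unique and vary smoothly
(`exists_smooth_section`, `exists_normalized_family`). So `V` is open and the normalized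
parametrization is a continuous section `s` over it. An embedding `φ` with image in `V` is `s (φ(M))
∘ γ φ` with `γ φ = r ∘ trunc p ∘ φ`, and `φ ↦ (φ(M), γ φ)` is the trivialization. Smooth dependence
of the inverse diffeomorphisms is another case of the section theorem (`contMDiffOn_symm_family`).

The members of `V` are images of `M`, so each stratum is open. The strata are disjoint because two
embeddings with the same image differ by a diffeomorphism, and they cover because a closed subset of
the cube is compact, so that each submanifold is itself a compact manifold.

Contractibility is the swindle in `ℝ^∞`: a straight line leads from `φ` to its copy in the odd
coordinates, and a second one from there to a fixed embedding in the even coordinates. -/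

namespace SubmanifoldSpace

open Filter Set

/-! ### Inverse function theorem and tangent vectors -/

section Calculus

variable {E F : Type*} [NormedAddCommGroup E] [NormedSpace ℝ E] [NormedAddCommGroup F]
  [NormedSpace ℝ F]

/-- The inverse function theorem on an open set, with a smooth inverse on the whole target. -/
theorem exists_smooth_openPartialHomeomorph [CompleteSpace E] {f : E → F} {O : Set E}
    (hO : IsOpen O) (hf : ContDiffOn ℝ ∞ f O) {a : E} (ha : a ∈ O) {f' : E ≃L[ℝ] F}
    (hf' : HasFDerivAt f (f' : E →L[ℝ] F) a) :
    ∃ Φ : OpenPartialHomeomorph E F, a ∈ Φ.source ∧ Φ.source ⊆ O ∧ (∀ x, Φ x = f x) ∧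
      ContDiffOn ℝ ∞ Φ.symm Φ.target := by
  have hfa : ContDiffAt ℝ ∞ f a := hf.contDiffAt (hO.mem_nhds ha)
  set Φ₀ := hfa.toOpenPartialHomeomorph f hf' (by simp) with hΦ₀
  have hcoe : (Φ₀ : E → F) = f := hfa.toOpenPartialHomeomorph_coe hf' (by simp)
  -- Invertibility of the derivative is an open condition. Restricting the source to it makes the
  -- inverse smooth on the whole target, not only at the image of `a`.
  set S : Set E := O ∩ fderiv ℝ f ⁻¹' (range ((↑) : (E ≃L[ℝ] F) → E →L[ℝ] F)) with hS
  have hSo : IsOpen S :=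
    (hf.continuousOn_fderiv_of_isOpen hO (by simp)).isOpen_inter_preimage hO
      ContinuousLinearEquiv.isOpen
  have haS : a ∈ S := ⟨ha, f', hf'.fderiv.symm⟩
  refine ⟨Φ₀.restrOpen S hSo, ?_, ?_, ?_, ?_⟩
  · exact ⟨hfa.mem_toOpenPartialHomeomorph_source hf' (by simp), haS⟩
  · exact fun x hx ↦ hx.2.1
  · exact fun x ↦ congrFun hcoe x
  · intro y hy
    have hx := (Φ₀.restrOpen S hSo).map_target hy
    obtain ⟨e, he⟩ := hx.2.2
    have hd : ContDiffAt ℝ ∞ f ((Φ₀.restrOpen S hSo).symm y) :=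
      hf.contDiffAt (hO.mem_nhds hx.2.1)
    refine ((Φ₀.restrOpen S hSo).contDiffAt_symm (f₀' := e) hy ?_ ?_).contDiffWithinAt
    · rw [he]
      exact ((hd.differentiableAt (by simp)).hasFDerivAt).congr_of_eventuallyEq
        (.of_eq hcoe)
    · exact hd.congr_of_eventuallyEq (.of_eq hcoe)

theorem exists_smooth_openPartialHomeomorph_of_surjective [FiniteDimensional ℝ E]
    [FiniteDimensional ℝ F] {f : E → F} {O : Set E}
    (hO : IsOpen O) (hf : ContDiffOn ℝ ∞ f O) {a : E} (ha : a ∈ O)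
    (hdim : Module.finrank ℝ E = Module.finrank ℝ F)
    (hs : Function.Surjective (fderiv ℝ f a)) :
    ∃ Φ : OpenPartialHomeomorph E F, a ∈ Φ.source ∧ Φ.source ⊆ O ∧ (∀ x, Φ x = f x) ∧
      ContDiffOn ℝ ∞ Φ.symm Φ.target := by
  have : CompleteSpace E := FiniteDimensional.complete ℝ E
  have : CompleteSpace F := FiniteDimensional.complete ℝ F
  have hi : Function.Injective (fderiv ℝ f a : E →ₗ[ℝ] F) :=
    (LinearMap.injective_iff_surjective_of_finrank_eq_finrank hdim).2 hs
  let f' : E ≃L[ℝ] F := ContinuousLinearEquiv.ofBijective (fderiv ℝ f a)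
    (LinearMap.ker_eq_bot.2 hi) (LinearMap.range_eq_top.2 hs)
  refine exists_smooth_openPartialHomeomorph hO hf ha (f' := f') ?_
  exact ((hf.contDiffAt (hO.mem_nhds ha)).differentiableAt (by simp)).hasFDerivAt

/-- The derivative of a map into a submanifold is tangent to it. -/
theorem IsSliceChart.fderiv_mem [FiniteDimensional ℝ E] {W : Set E} {L : Submodule ℝ E}
    {Φ : OpenPartialHomeomorph E E} (h : IsSliceChart W L Φ) {γ : F → E} {a : F} {γ' : F →L[ℝ] E}
    (hγ : HasFDerivAt γ γ' a) (ha : γ a ∈ Φ.source) (hW : ∀ᶠ t in 𝓝 a, γ t ∈ W) (w : F) :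
    fderiv ℝ Φ (γ a) (γ' w) ∈ L := by
  have hΦ : HasFDerivAt Φ (fderiv ℝ Φ (γ a)) (γ a) :=
    ((h.contDiffOn.contDiffAt (Φ.open_source.mem_nhds ha)).differentiableAt (by simp)).hasFDerivAt
  have hline : HasDerivAt (fun t : ℝ ↦ a + t • w) w 0 := by
    simpa using ((hasDerivAt_id (0 : ℝ)).smul_const w).const_add a
  have hc : HasDerivAt (fun t : ℝ ↦ Φ (γ (a + t • w))) (fderiv ℝ Φ (γ a) (γ' w)) 0 := by
    have h1 : HasFDerivAt (fun x ↦ Φ (γ x)) ((fderiv ℝ Φ (γ a)).comp γ') (a + (0 : ℝ) • w) := by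
      simpa [Function.comp_def] using hΦ.comp a hγ
    have h2 := HasFDerivAt.comp_hasDerivAt (0 : ℝ) h1 hline
    exact h2
  have hlim := hasDerivAt_iff_tendsto_slope_zero.1 hc
  have hcont : Tendsto (fun t : ℝ ↦ a + t • w) (𝓝 0) (𝓝 a) := by
    simpa using hline.continuousAt.tendsto
  have hev : ∀ᶠ t in 𝓝 a, Φ (γ t) ∈ L := by
    filter_upwards [hW, hγ.continuousAt.eventually (Φ.open_source.mem_nhds ha)] with t h1 h2
    exact (h.mem_iff _ h2).2 h1
  -- The difference quotients of `Φ ∘ γ` in direction `w` lie in the closed subspace `L`, hence so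
  -- does their limit.
  have hclosed : IsClosed (L : Set E) := L.closed_of_finiteDimensional
  refine hclosed.mem_of_tendsto hlim ?_
  filter_upwards [nhdsWithin_le_nhds (hcont.eventually hev)] with t ht
  refine L.smul_mem _ (L.sub_mem ?_ ?_)
  · simpa using ht
  · simpa using hev.self_of_nhds

theorem IsSliceChart.fderiv_symm_fderiv {W : Set E} {L : Submodule ℝ E}
    {Φ : OpenPartialHomeomorph E E} (h : IsSliceChart W L Φ) {x : E} (hx : x ∈ Φ.source) (v : E) :
    fderiv ℝ Φ.symm (Φ x) (fderiv ℝ Φ x v) = v := by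
  have h1 : HasFDerivAt Φ (fderiv ℝ Φ x) x :=
    ((h.contDiffOn.contDiffAt (Φ.open_source.mem_nhds hx)).differentiableAt (by simp)).hasFDerivAt
  have h2 : HasFDerivAt Φ.symm (fderiv ℝ Φ.symm (Φ x)) (Φ x) :=
    ((h.contDiffOn_symm.contDiffAt (Φ.open_target.mem_nhds (Φ.map_source hx))).differentiableAt
      (by simp)).hasFDerivAt
  have h3 : HasFDerivAt (fun y ↦ Φ.symm (Φ y)) (ContinuousLinearMap.id ℝ E) x := by
    refine (hasFDerivAt_id x).congr_of_eventuallyEq ?_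
    filter_upwards [Φ.open_source.mem_nhds hx] with y hy
    exact Φ.left_inv hy
  exact congrArg (fun T : E →L[ℝ] E ↦ T v) ((h2.comp x h1).unique h3)

/-- Tangent vectors do not depend on the slice chart. -/
theorem IsSliceChart.fderiv_mem_of_mem_tangentVectors [FiniteDimensional ℝ E] {W : Set E}
    {L : Submodule ℝ E} {Φ : OpenPartialHomeomorph E E} (h : IsSliceChart W L Φ) {x v : E}
    (hxW : x ∈ W) (hx : x ∈ Φ.source) (hv : v ∈ tangentVectors W x) : fderiv ℝ Φ x v ∈ L := by
  obtain ⟨L', Φ', hx', h', hv'⟩ := hv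
  -- The line through `Φ' x` with direction `fderiv ℝ Φ' x v` stays in `L'`. Carried back by
  -- `Φ'.symm` it is a curve in `W` with velocity `v`, to which `IsSliceChart.fderiv_mem` applies.
  have hline : HasFDerivAt (fun t : ℝ ↦ Φ' x + t • fderiv ℝ Φ' x v)
      (ContinuousLinearMap.toSpanSingleton ℝ (fderiv ℝ Φ' x v)) 0 := by
    have := ((hasDerivAt_id (0 : ℝ)).smul_const (fderiv ℝ Φ' x v)).const_add (Φ' x)
    simpa [ContinuousLinearMap.toSpanSingleton] using this.hasFDerivAt
  have h2 : HasFDerivAt Φ'.symm (fderiv ℝ Φ'.symm (Φ' x)) (Φ' x) :=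
    ((h'.contDiffOn_symm.contDiffAt (Φ'.open_target.mem_nhds (Φ'.map_source hx'))).differentiableAt
      (by simp)).hasFDerivAt
  have h2' : HasFDerivAt Φ'.symm (fderiv ℝ Φ'.symm (Φ' x))
    (Φ' x + (0 : ℝ) • fderiv ℝ Φ' x v) := by simpa using h2
  have hγ := h2'.comp (0 : ℝ) hline
  have hx0 : Φ'.symm (Φ' x + (0 : ℝ) • fderiv ℝ Φ' x v) = x := by simp [Φ'.left_inv hx']
  have hcont : Tendsto (fun t : ℝ ↦ Φ' x + t • fderiv ℝ Φ' x v) (𝓝 0) (𝓝 (Φ' x)) := by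
    simpa using hline.continuousAt.tendsto
  have key := h.fderiv_mem hγ (by rw [Function.comp_apply, hx0]; exact hx) (by
    filter_upwards [hcont.eventually (Φ'.open_target.mem_nhds (Φ'.map_source hx'))] with t ht
    rw [Function.comp_apply, ← h'.mem_iff _ (Φ'.map_target ht), Φ'.right_inv ht]
    exact L'.add_mem ((h'.mem_iff x hx').2 hxW) (L'.smul_mem _ hv')) 1
  simpa [Φ'.left_inv hx', ContinuousLinearMap.toSpanSingleton_apply,
    h'.fderiv_symm_fderiv hx'] using key

end Calculus

/-! ### Images of embeddings are submanifolds -/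

section Embeddings

variable {E F H N : Type*} [NormedAddCommGroup E] [NormedSpace ℝ E]
  [NormedAddCommGroup F] [NormedSpace ℝ F] [TopologicalSpace H]
  [TopologicalSpace N] [ChartedSpace H N] {I : ModelWithCorners ℝ F H} [I.Boundaryless]

omit [I.Boundaryless] in
theorem _root_.ContMDiff.contDiffOn_extChartAt_symm [IsManifold I ∞ N] {f : N → E}
    (hf : ContMDiff I 𝓘(ℝ, E) ∞ f) (x : N) :
    ContDiffOn ℝ ∞ (f ∘ (extChartAt I x).symm) (extChartAt I x).target :=
  contMDiffOn_iff_contDiffOn.1 (hf.comp_contMDiffOn (contMDiffOn_extChartAt_symm x))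

theorem IsSmoothEmb.injective_fderiv {f : N → E} (hf : IsSmoothEmb I f) (x : N) :
    Function.Injective (fderiv ℝ (f ∘ (extChartAt I x).symm) (extChartAt I x x)) := by
  have e : fderiv ℝ (f ∘ (extChartAt I x).symm) (extChartAt I x x) = mfderiv I 𝓘(ℝ, E) f x := by
    refine Eq.trans ?_ (hf.contMDiff.mdifferentiableAt (by simp)).mfderiv.symm
    rw [I.range_eq_univ, fderivWithin_univ]
    rfl
  rw [e]
  exact hf.injective_mfderiv x

/-- The image of a smooth embedding is a submanifold. -/
theorem IsSmoothEmb.isSubmanifold_range [FiniteDimensional ℝ F] [FiniteDimensional ℝ E]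
    [IsManifold I ∞ N] {f : N → E} (hf : IsSmoothEmb I f) :
    IsSubmanifold (Module.finrank ℝ F) (range f) := by
  rintro _ ⟨x, rfl⟩
  have : CompleteSpace E := FiniteDimensional.complete ℝ E
  set c := extChartAt I x with hc
  set G := f ∘ c.symm with hG
  have hGs : ContDiffOn ℝ ∞ G c.target := hf.contMDiff.contDiffOn_extChartAt_symm x
  have hto : IsOpen c.target := isOpen_extChartAt_target x
  have hcx : c x ∈ c.target := mem_extChartAt_target x
  set D := fderiv ℝ G (c x) with hD
  have hDi : Function.Injective D := hf.injective_fderiv x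
  obtain ⟨A₀, hA₀⟩ := LinearMap.exists_leftInverse_of_injective (D : F →ₗ[ℝ] E)
    (LinearMap.ker_eq_bot.2 hDi)
  let A : E →L[ℝ] F := LinearMap.toContinuousLinearMap A₀
  have hAD : ∀ v, A (D v) = v := fun v ↦ LinearMap.congr_fun hA₀ v
  -- With `A` a left inverse of `D`, this map satisfies `Ψ (D v) = G v` and has derivative `D A + (1
  -- - D A) = 1` at `D (c x)`. It thus bends the linear subspace `range D` onto the image of `f`,
  -- and its local inverse is a slice chart.
  let Ψ : E → E := fun e ↦ G (A e) + (e - D (A e))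
  set O : Set E := A ⁻¹' c.target with hO
  have hOo : IsOpen O := hto.preimage A.continuous
  have haO : D (c x) ∈ O := by simpa [hO, hAD] using hcx
  have hΨ : ContDiffOn ℝ ∞ Ψ O :=
    (hGs.comp A.contDiff.contDiffOn (fun _ h ↦ h)).add
      (contDiff_id.sub (D.contDiff.comp A.contDiff)).contDiffOn
  have hΨ' : HasFDerivAt Ψ ((ContinuousLinearEquiv.refl ℝ E : E ≃L[ℝ] E) : E →L[ℝ] E)
      (D (c x)) := by
    have hGd : HasFDerivAt G D (A (D (c x))) := by
      rw [hAD]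
      exact ((hGs.contDiffAt (hto.mem_nhds hcx)).differentiableAt (by simp)).hasFDerivAt
    have h1 := (hGd.comp _ A.hasFDerivAt).add
      ((hasFDerivAt_id (D (c x))).sub (D.hasFDerivAt.comp _ A.hasFDerivAt))
    refine h1.congr_fderiv ?_
    ext v
    simp
  obtain ⟨Θ, haΘ, hΘO, hΘ, hΘs⟩ := exists_smooth_openPartialHomeomorph hOo hΨ haO hΨ'
  have hΨx : Ψ (D (c x)) = f x := by
    simp [Ψ, hAD, hG, hc]
  -- a neighbourhood of `f x` in which points of the image come from the chart
  have hnear : ∀ᶠ y in 𝓝 (f x), ∀ x', f x' = y → x' ∈ c.source ∧ D (c x') ∈ Θ.source := by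
    have h1 : ∀ᶠ x' in 𝓝 x, x' ∈ c.source ∧ D (c x') ∈ Θ.source := by
      refine Filter.Eventually.and (extChartAt_source_mem_nhds x) ?_
      exact (D.continuous.continuousAt.comp (continuousAt_extChartAt x)).eventually
        (Θ.open_source.mem_nhds haΘ)
    rw [hf.isEmbedding.nhds_eq_comap, eventually_comap] at h1
    exact h1
  obtain ⟨U, hU, hUo, hxU⟩ := eventually_nhds_iff.1 hnear
  refine ⟨LinearMap.range (D : F →ₗ[ℝ] E), Θ.symm.restrOpen U hUo, ?_, ?_, ?_⟩
  · refine ⟨?_, hxU⟩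
    have := Θ.map_source haΘ
    rwa [hΘ, hΨx] at this
  · exact LinearMap.finrank_range_of_inj hDi
  · refine ⟨hΘs.mono fun y hy ↦ hy.1, ?_, ?_⟩
    · have : ContDiffOn ℝ ∞ Θ Θ.source := (hΨ.mono hΘO).congr fun y _ ↦ hΘ y
      exact this.mono fun y hy ↦ hy.1
    · rintro y ⟨hy, hyU⟩
      constructor
      · rintro ⟨v, hv⟩
        have hv' : D v = Θ.symm y := hv
        have h1 : Θ (Θ.symm y) = y := Θ.right_inv hy
        rw [hΘ, ← hv'] at h1
        exact ⟨c.symm v, by simpa [Ψ, hAD, hG] using h1⟩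
      · rintro ⟨x', rfl⟩
        obtain ⟨hx', hx''⟩ := hU _ hyU x' rfl
        have h1 : Θ (D (c x')) = f x' := by
          rw [hΘ]
          simp [Ψ, hAD, hG, c.left_inv hx']
        refine ⟨c x', ?_⟩
        change D (c x') = Θ.symm (f x')
        rw [← h1, Θ.left_inv hx'']

end Embeddings

/-! ### Nearest-point retraction onto a compact submanifold -/

section Retraction

variable {E F H N : Type*} [NormedAddCommGroup E] [InnerProductSpace ℝ E] [FiniteDimensional ℝ E]
  [NormedAddCommGroup F] [NormedSpace ℝ F] [FiniteDimensional ℝ F] [TopologicalSpace H]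
  [TopologicalSpace N] [ChartedSpace H N] {I : ModelWithCorners ℝ F H} [I.Boundaryless]
  [IsManifold I ∞ N]

/-- The map `(y, x) ↦ (⟪x - φ y, Dφ y -⟫, x)`, whose zero set in the first component consists of
the pairs for which `x - φ y` is normal to the image of `φ` at `φ y`. -/
def normalMap (φ : F → E) (z : F × E) : (F →L[ℝ] ℝ) × E :=
  ((innerSL ℝ (z.2 - φ z.1)).comp (fderiv ℝ φ z.1), z.2)

omit [FiniteDimensional ℝ E] [FiniteDimensional ℝ F] in
theorem contDiffOn_normalMap {φ : F → E} {T : Set F} (hT : IsOpen T) (hφ : ContDiffOn ℝ ∞ φ T) :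
    ContDiffOn ℝ ∞ (normalMap φ) (T ×ˢ univ) := by
  have h1 : ContDiffOn ℝ ∞ (fderiv ℝ φ) T := hφ.fderiv_of_isOpen hT (by simp)
  have hfst : ContDiffOn ℝ ∞ (Prod.fst : F × E → F) (T ×ˢ univ) := contDiff_fst.contDiffOn
  have hmap : MapsTo (Prod.fst : F × E → F) (T ×ˢ univ) T := fun z hz ↦ hz.1
  refine ContDiffOn.prodMk (ContDiffOn.clm_comp ?_ (h1.comp hfst hmap)) contDiff_snd.contDiffOn
  exact (innerSL ℝ (E := E)).contDiff.comp_contDiffOn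
    (contDiff_snd.contDiffOn.sub (hφ.comp hfst hmap))

/-- The dimensions agree, so injectivity suffices. A kernel vector has the form `(w, 0)`; the second
derivative of `φ` drops out because `x - φ y` vanishes at the base point, and evaluating the
remaining functional at `w` gives `-‖Dφ w‖²`. -/
theorem surjective_fderiv_normalMap {φ : F → E} {T : Set F} (hT : IsOpen T)
    (hφ : ContDiffOn ℝ ∞ φ T) {y : F} (hy : y ∈ T) (hi : Function.Injective (fderiv ℝ φ y)) :
    Function.Surjective (fderiv ℝ (normalMap φ) (y, φ y)) := by
  have hdim : Module.finrank ℝ (F × E) = Module.finrank ℝ ((F →L[ℝ] ℝ) × E) := by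
    rw [Module.finrank_prod, Module.finrank_prod,
      ← (LinearMap.toContinuousLinearMap (𝕜 := ℝ) (E := F) (F' := ℝ)).finrank_eq,
      Module.finrank_linearMap_self]
  refine (LinearMap.injective_iff_surjective_of_finrank_eq_finrank
    (f := (fderiv ℝ (normalMap φ) (y, φ y) : F × E →ₗ[ℝ] (F →L[ℝ] ℝ) × E)) hdim).1 ?_
  have hφy : HasFDerivAt φ (fderiv ℝ φ y) y :=
    ((hφ.contDiffAt (hT.mem_nhds hy)).differentiableAt (by simp)).hasFDerivAt
  have h1 : ContDiffOn ℝ ∞ (fderiv ℝ φ) T := hφ.fderiv_of_isOpen hT (by simp)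
  have hDy : HasFDerivAt (fderiv ℝ φ) (fderiv ℝ (fderiv ℝ φ) y) y :=
    ((h1.contDiffAt (hT.mem_nhds hy)).differentiableAt (by simp)).hasFDerivAt
  have hfst : HasFDerivAt (Prod.fst : F × E → F) (ContinuousLinearMap.fst ℝ F E) (y, φ y) :=
    hasFDerivAt_fst
  have hsnd : HasFDerivAt (Prod.snd : F × E → E) (ContinuousLinearMap.snd ℝ F E) (y, φ y) :=
    hasFDerivAt_snd
  have hc := (innerSL ℝ (E := E)).hasFDerivAt.comp (y, φ y) (hsnd.sub (hφy.comp (y, φ y) hfst))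
  have hN := (hc.clm_comp (hDy.comp (y, φ y) hfst)).prodMk hsnd
  have hN' : HasFDerivAt (normalMap φ) _ (y, φ y) := hN
  rw [hN'.fderiv]
  refine (injective_iff_map_eq_zero _).2 ?_
  rintro ⟨w, w'⟩ h
  have hw' : w' = 0 := congrArg Prod.snd h
  subst hw'
  have h0 := congrArg (fun p : (F →L[ℝ] ℝ) × E ↦ p.1 w) h
  have h2 : fderiv ℝ φ y w = 0 := by
    simp at h0
    exact inner_self_eq_zero (𝕜 := ℝ).1 h0
  rw [(injective_iff_map_eq_zero _).1 hi w h2]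
  rfl

/-- A smooth retraction of a neighbourhood of a compact submanifold of a Euclidean space. -/
theorem IsSmoothEmb.exists_retraction [CompactSpace N] [Nonempty N] {φ : N → E}
    (hφ : IsSmoothEmb I φ) :
    ∃ (O : Set E) (r : E → N), IsOpen O ∧ ContMDiffOn 𝓘(ℝ, E) I ∞ r O ∧ ∀ m, φ m ∈ O ∧ r (φ m) = m := by
  have hmin : ∀ x : E, ∃ m : N, ∀ m', ‖x - φ m‖ ≤ ‖x - φ m'‖ := by
    intro x
    obtain ⟨m, -, hm⟩ := isCompact_univ.exists_isMinOn (univ_nonempty (α := N))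
      (f := fun m ↦ ‖x - φ m‖) (by
        have := hφ.contMDiff.continuous
        fun_prop)
    exact ⟨m, fun m' ↦ hm (mem_univ m')⟩
  -- Nearest points need not be unique, and `r` picks one arbitrarily. Near the image the
  -- first-order condition pins the choice down.
  choose r hr using hmin
  have hrφ : ∀ m, r (φ m) = m := by
    intro m
    have := hr (φ m) m
    rw [sub_self, norm_zero, norm_le_zero_iff, sub_eq_zero] at this
    exact (hφ.isEmbedding.injective this).symm
  have hlim : ∀ m, Tendsto r (𝓝 (φ m)) (𝓝 m) := by
    intro m
    rw [hφ.isEmbedding.nhds_eq_comap, tendsto_comap_iff, tendsto_iff_norm_sub_tendsto_zero]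
    have h2 : Tendsto (fun x ↦ 2 * ‖x - φ m‖) (𝓝 (φ m)) (𝓝 0) := by
      have : Continuous fun x ↦ 2 * ‖x - φ m‖ := by fun_prop
      simpa using this.tendsto (φ m)
    refine squeeze_zero (fun _ ↦ norm_nonneg _) (fun x ↦ ?_) h2
    calc ‖φ (r x) - φ m‖ = ‖(x - φ m) - (x - φ (r x))‖ := by congr 1; abel
      _ ≤ ‖x - φ m‖ + ‖x - φ (r x)‖ := norm_sub_le _ _
      _ ≤ 2 * ‖x - φ m‖ := by linarith [hr x m]
  have hloc : ∀ m, ∀ᶠ x in 𝓝 (φ m), ContMDiffAt 𝓘(ℝ, E) I ∞ r x := by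
    intro m
    set c := extChartAt I m with hc
    set G := φ ∘ c.symm with hG
    have hGs : ContDiffOn ℝ ∞ G c.target := hφ.contMDiff.contDiffOn_extChartAt_symm m
    have hto : IsOpen c.target := isOpen_extChartAt_target m
    have hcm : c m ∈ c.target := mem_extChartAt_target m
    have hGm : G (c m) = φ m := by simp [hG, hc]
    have hsurj := surjective_fderiv_normalMap hto hGs hcm (hφ.injective_fderiv m)
    rw [hGm] at hsurj
    have hdim : Module.finrank ℝ (F × E) = Module.finrank ℝ ((F →L[ℝ] ℝ) × E) := by
      rw [Module.finrank_prod, Module.finrank_prod,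
        ← (LinearMap.toContinuousLinearMap (𝕜 := ℝ) (E := F) (F' := ℝ)).finrank_eq,
        Module.finrank_linearMap_self]
    obtain ⟨Θ, hmΘ, hΘO, hΘ, hΘs⟩ := exists_smooth_openPartialHomeomorph_of_surjective
      (hto.prod isOpen_univ) (contDiffOn_normalMap hto hGs) (a := (c m, φ m))
      ⟨hcm, mem_univ _⟩ hdim hsurj
    have hev : ∀ᶠ x in 𝓝 (φ m), r x ∈ c.source ∧ (c (r x), x) ∈ Θ.source := by
      refine ((hlim m).eventually (extChartAt_source_mem_nhds m)).and ?_
      have : Tendsto (fun x ↦ (c (r x), x)) (𝓝 (φ m)) (𝓝 (c m, φ m)) :=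
        ((continuousAt_extChartAt m).tendsto.comp (hlim m)).prodMk_nhds tendsto_id
      exact this.eventually (Θ.open_source.mem_nhds hmΘ)
    -- At a minimum of the distance, `x - φ (r x)` is normal to the image, so `Θ` takes the value
    -- `(0, x)` at `(c (r x), x)`. Inverting `Θ` then expresses `r` by a smooth formula.
    have hcrit : ∀ x, r x ∈ c.source → (c (r x), x) ∈ Θ.source → Θ (c (r x), x) = (0, x) := by
      intro x hx hxΘ
      rw [hΘ]
      refine Prod.ext ?_ rfl
      have hcx : c (r x) ∈ c.target := c.map_source hx
      have hGd : HasFDerivAt G (fderiv ℝ G (c (r x))) (c (r x)) :=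
        ((hGs.contDiffAt (hto.mem_nhds hcx)).differentiableAt (by simp)).hasFDerivAt
      have hloc : IsLocalMin (fun y ↦ ‖x - G y‖ ^ 2) (c (r x)) := by
        refine Eventually.of_forall fun y ↦ ?_
        have h1 : G (c (r x)) = φ (r x) := by simp [hG, c.left_inv hx]
        have h2 := hr x (c.symm y)
        change ‖x - G (c (r x))‖ ^ 2 ≤ ‖x - G y‖ ^ 2
        rw [h1]
        gcongr
        exact h2
      have h0 := hloc.hasFDerivAt_eq_zero (hGd.const_sub x).norm_sq
      ext v
      have := congrArg (fun T : F →L[ℝ] ℝ ↦ T v) h0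
      have h4 : inner ℝ (G (c (r x))) (fderiv ℝ G (c (r x)) v) -
          inner ℝ x (fderiv ℝ G (c (r x)) v) = 0 := by simpa using this
      simpa [normalMap] using (by linarith : inner ℝ x (fderiv ℝ G (c (r x)) v) -
        inner ℝ (G (c (r x))) (fderiv ℝ G (c (r x)) v) = 0)
    have hev' := eventually_eventually_nhds.2 hev
    filter_upwards [hev'] with x hx
    obtain ⟨hx1, hx2⟩ := hx.self_of_nhds
    have hformula : r =ᶠ[𝓝 x] fun x' ↦ c.symm (Θ.symm ((0 : F →L[ℝ] ℝ), x')).1 := by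
      filter_upwards [hx] with x' hx'
      rw [← hcrit x' hx'.1 hx'.2, Θ.left_inv hx'.2]
      exact (c.left_inv hx'.1).symm
    have hxt : ((0 : F →L[ℝ] ℝ), x) ∈ Θ.target := by
      rw [← hcrit x hx1 hx2]
      exact Θ.map_source hx2
    have hin : ContDiffAt ℝ ∞ (fun x' : E ↦ (Θ.symm ((0 : F →L[ℝ] ℝ), x')).1) x :=
      (hΘs.contDiffAt (Θ.open_target.mem_nhds hxt)).fst.comp x
        (contDiffAt_const.prodMk contDiffAt_id)
    have hct : (Θ.symm ((0 : F →L[ℝ] ℝ), x)).1 ∈ c.target := (hΘO (Θ.map_target hxt)).1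
    refine ContMDiffAt.congr_of_eventuallyEq ?_ hformula
    exact ((contMDiffOn_extChartAt_symm (I := I) (n := ∞) m).contMDiffAt (hto.mem_nhds hct)).comp x
      hin.contMDiffAt
  refine ⟨{x | ∀ᶠ x' in 𝓝 x, ContMDiffAt 𝓘(ℝ, E) I ∞ r x'}, r, isOpen_setOfPred_eventually_nhds,
    fun x hx ↦ (hx.self_of_nhds).contMDiffWithinAt, fun m ↦ ⟨hloc m, hrφ m⟩⟩

end Retraction

/-! ### Smooth sections of families of submanifolds -/

section Sections

variable {d n q : ℕ} {M : CompactManifold d} {Γ N : Set (Euc n × Euc q)}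
  {ρ : Euc n × Euc q → M} {u₀ : Euc n} {φ : M → Euc q}

/-- Near a point of a family `Γ` of submanifolds, a fibrewise diffeomorphism `ρ : Γ → M` has a
smooth inverse. -/
theorem exists_local_section (hsub : IsSubmanifold (n + d) Γ)
    (hsubm : ∀ z ∈ Γ, ∀ u : Euc n, ∃ v ∈ tangentVectors Γ z, v.1 = u)
    (hN : IsOpen N) (hρ : ContMDiffOn 𝓘(ℝ, Euc n × Euc q) (𝓡 d) ∞ ρ N)
    (hφ : ContMDiff (𝓡 d) (𝓡 q) ∞ φ) (hφΓ : ∀ m, (u₀, φ m) ∈ Γ) (hφN : ∀ m, (u₀, φ m) ∈ N)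
    (hρφ : ∀ m, ρ (u₀, φ m) = m) (m₀ : M) :
    ∃ σ : Euc n × M → Euc q,
      (∀ᶠ w in 𝓝 (u₀, m₀), ContMDiffAt ((𝓡 n).prod (𝓡 d)) (𝓡 q) ∞ σ w ∧
        (w.1, σ w) ∈ Γ ∧ ρ (w.1, σ w) = w.2) ∧
      ∀ᶠ z in 𝓝 (u₀, φ m₀), z ∈ Γ → σ (z.1, ρ z) = z.2 := by
  obtain ⟨L, Φ, hzΦ, hL, hΦ⟩ := hsub _ (hφΓ m₀)
  set z₀ : Euc n × Euc q := (u₀, φ m₀) with hz₀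
  set c := extChartAt (𝓡 d) m₀ with hc
  have hto : IsOpen c.target := isOpen_extChartAt_target m₀
  have hso : IsOpen c.source := isOpen_extChartAt_source m₀
  have hcm : c m₀ ∈ c.target := mem_extChartAt_target m₀
  have hms : m₀ ∈ c.source := mem_extChartAt_source m₀
  set O₁ : Set (Euc n × Euc q) := N ∩ ρ ⁻¹' c.source with hO₁
  have hO₁o : IsOpen O₁ := hρ.continuousOn.isOpen_inter_preimage hN hso
  have hz₁ : z₀ ∈ O₁ := ⟨hφN m₀, by simpa [hz₀, hρφ] using hms⟩
  have hcρ : ContDiffOn ℝ ∞ (fun z ↦ c (ρ z)) O₁ := by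
    rw [← contMDiffOn_iff_contDiffOn]
    refine ContMDiffOn.comp (t := c.source) ?_ (hρ.mono inter_subset_left) inter_subset_right
    have := contMDiffOn_extChartAt (I := 𝓡 d) (n := ∞) (x := m₀)
    rwa [← extChartAt_source (𝓡 d)] at this
  set Θ : Euc n × Euc q → Euc n × Euc d := fun z ↦ (z.1, c (ρ z)) with hΘ
  have hΘs : ContDiffOn ℝ ∞ Θ O₁ := contDiff_fst.contDiffOn.prodMk hcρ
  set D := fderiv ℝ (fun z ↦ c (ρ z)) z₀ with hD
  have hDd : HasFDerivAt (fun z ↦ c (ρ z)) D z₀ :=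
    ((hcρ.contDiffAt (hO₁o.mem_nhds hz₁)).differentiableAt (by simp)).hasFDerivAt
  have hΘd : HasFDerivAt Θ ((ContinuousLinearMap.fst ℝ (Euc n) (Euc q)).prod D) z₀ :=
    hasFDerivAt_fst.prodMk hDd
  -- the derivative along the fibre over `u₀`
  set G : Euc d → Euc n × Euc q := fun y ↦ (u₀, φ (c.symm y)) with hG
  have hφs := hφ.contDiffOn_extChartAt_symm m₀
  have hGm : G (c m₀) = z₀ := by simp [hG, hz₀, hc]
  set φ' := fderiv ℝ (φ ∘ c.symm) (c m₀)
  have hGd : HasFDerivAt G ((0 : Euc d →L[ℝ] Euc n).prod φ') (c m₀) :=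
    (hasFDerivAt_const u₀ (c m₀)).prodMk
      ((hφs.contDiffAt (hto.mem_nhds hcm)).differentiableAt (by simp)).hasFDerivAt
  -- Along the fibre over `u₀`, `ρ` is inverse to `φ`, so `D` is a left inverse of `φ'` on vertical
  -- vectors.
  have hDG : ∀ w, D (0, φ' w) = w := by
    intro w
    have h1 : HasFDerivAt (fun y ↦ c (ρ (G y))) (ContinuousLinearMap.id ℝ (Euc d)) (c m₀) := by
      refine (hasFDerivAt_id (c m₀)).congr_of_eventuallyEq ?_
      filter_upwards [hto.mem_nhds hcm] with y hy
      simp only [hG, hρφ, id]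
      exact c.right_inv hy
    rw [← hGm] at hDd
    exact congrArg (fun T : Euc d →L[ℝ] Euc d ↦ T w) ((hDd.comp (c m₀) hGd).unique h1)
  set S := fderiv ℝ Φ.symm (Φ z₀) with hS
  have hSd : HasFDerivAt Φ.symm S (Φ z₀) :=
    ((hΦ.contDiffOn_symm.contDiffAt (Φ.open_target.mem_nhds (Φ.map_source hzΦ))).differentiableAt
      (by simp)).hasFDerivAt
  -- Through `Φ.symm`, the linear space `L` of dimension `n + d` parametrizes `Γ` near `z₀`; the
  -- inverse function theorem is applied to `Θ` in this parameter.
  set l₀ : L := ⟨Φ z₀, (hΦ.mem_iff _ hzΦ).2 (hφΓ m₀)⟩ with hl₀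
  set P : L → Euc n × Euc q := fun l ↦ Φ.symm l with hP
  have hPl : P l₀ = z₀ := Φ.left_inv hzΦ
  have hPd : HasFDerivAt P (S.comp L.subtypeL) l₀ := hSd.comp l₀ L.subtypeL.hasFDerivAt
  set T : Set L := ((↑) : L → Euc n × Euc q) ⁻¹' (Φ.target ∩ Φ.symm ⁻¹' O₁) with hT
  have hTo : IsOpen T :=
    (Φ.symm.isOpen_inter_preimage hO₁o).preimage continuous_subtype_val
  have hlT : l₀ ∈ T := ⟨Φ.map_source hzΦ, by
    change Φ.symm (Φ z₀) ∈ O₁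
    rwa [Φ.left_inv hzΦ]⟩
  have hPs : ContDiffOn ℝ ∞ P T :=
    hΦ.contDiffOn_symm.comp L.subtypeL.contDiff.contDiffOn fun l hl ↦ hl.1
  have hΘP : ContDiffOn ℝ ∞ (fun l ↦ Θ (P l)) T := hΘs.comp hPs fun l hl ↦ hl.2
  -- To hit `(a, b)`, lift `a` to a tangent vector `v` by the submersion hypothesis and add the
  -- vertical vector `(0, φ' (b - D v))`, which corrects the second component without changing the
  -- first.
  have hsurj : Function.Surjective (fderiv ℝ (fun l ↦ Θ (P l)) l₀) := by
    rw [← hPl] at hΘd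
    have h1 := hΘd.comp l₀ hPd
    rw [show (fun l ↦ Θ (P l)) = Θ ∘ P from rfl, h1.fderiv]
    rintro ⟨a, b⟩
    obtain ⟨v, hv, hva⟩ := hsubm z₀ (hφΓ m₀) a
    have hv1 := hΦ.fderiv_mem_of_mem_tangentVectors (hφΓ m₀) hzΦ hv
    have hv2 : fderiv ℝ Φ z₀ (0, φ' (b - D v)) ∈ L := by
      have := hΦ.fderiv_mem hGd (by rwa [hGm]) (.of_forall fun y ↦ hφΓ _) (b - D v)
      rwa [hGm] at this
    refine ⟨⟨fderiv ℝ Φ z₀ (v + (0, φ' (b - D v))), ?_⟩, ?_⟩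
    · rw [map_add]
      exact L.add_mem hv1 hv2
    · have h2 : S (fderiv ℝ Φ z₀ (v + (0, φ' (b - D v)))) = v + (0, φ' (b - D v)) :=
        hΦ.fderiv_symm_fderiv hzΦ _
      change (ContinuousLinearMap.prod _ D) (S (fderiv ℝ Φ z₀ (v + (0, φ' (b - D v))))) = _
      rw [h2]
      refine Prod.ext ?_ ?_
      · simp [hva]
      · change D (v + (0, φ' (b - D v))) = b
        rw [map_add, hDG]
        abel
  obtain ⟨Λ, hlΛ, hΛT, hΛ, hΛs⟩ := exists_smooth_openPartialHomeomorph_of_surjective hTo hΘP hlT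
    (by rw [hL]; simp) hsurj
  have hΛl : Λ l₀ = (u₀, c m₀) := by
    rw [hΛ, hPl]
    simp [hΘ, hz₀, hρφ]
  refine ⟨fun w ↦ (P (Λ.symm (w.1, c w.2))).2, ?_, ?_⟩
  · have hpair : ContMDiffOn ((𝓡 n).prod (𝓡 d)) ((𝓡 n).prod (𝓡 d)) ∞
        (fun w : Euc n × M ↦ (w.1, c w.2)) (univ ×ˢ c.source) := by
      refine contMDiff_fst.contMDiffOn.prodMk ?_
      refine ContMDiffOn.comp (t := c.source) ?_ contMDiff_snd.contMDiffOn fun w hw ↦ hw.2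
      have := contMDiffOn_extChartAt (I := 𝓡 d) (n := ∞) (x := m₀)
      rwa [← extChartAt_source (𝓡 d)] at this
    set Q : Set (Euc n × M) := (univ ×ˢ c.source) ∩ (fun w : Euc n × M ↦ (w.1, c w.2)) ⁻¹' Λ.target
      with hQ
    have hQo : IsOpen Q :=
      hpair.continuousOn.isOpen_inter_preimage (isOpen_univ.prod hso) Λ.open_target
    have hwQ : (u₀, m₀) ∈ Q := by
      refine ⟨⟨mem_univ _, hms⟩, ?_⟩
      change (u₀, c m₀) ∈ Λ.target
      rw [← hΛl]
      exact Λ.map_source hlΛ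
    filter_upwards [hQo.mem_nhds hwQ] with w hw
    have hw2 : (w.1, c w.2) ∈ Λ.target := hw.2
    have hlT' := hΛT (Λ.map_target hw2)
    have h1 : Θ (P (Λ.symm (w.1, c w.2))) = (w.1, c w.2) := by
      rw [← hΛ, Λ.right_inv hw2]
    have h11 : (P (Λ.symm (w.1, c w.2))).1 = w.1 := congrArg Prod.fst h1
    have h12 : c (ρ (P (Λ.symm (w.1, c w.2)))) = c w.2 := congrArg Prod.snd h1
    have h13 : (w.1, (P (Λ.symm (w.1, c w.2))).2) = P (Λ.symm (w.1, c w.2)) :=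
      Prod.ext h11.symm rfl
    refine ⟨?_, ?_, ?_⟩
    · have h2 : ContMDiffAt ((𝓡 n).prod (𝓡 d)) 𝓘(ℝ, Euc n × Euc d) ∞
          (fun w : Euc n × M ↦ (w.1, c w.2)) w := by
        rw [modelWithCornersSelf_prod, ← chartedSpaceSelf_prod]
        exact hpair.contMDiffAt ((isOpen_univ.prod hso).mem_nhds hw.1)
      have h3 : ContDiffAt ℝ ∞ (fun y ↦ (P (Λ.symm y)).2) (w.1, c w.2) :=
        (((hPs.contDiffAt (hTo.mem_nhds hlT'))).comp (w.1, c w.2)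
          (hΛs.contDiffAt (Λ.open_target.mem_nhds hw2))).snd
      have h4 := ContMDiffAt.comp (g := fun y ↦ (P (Λ.symm y)).2) w h3.contMDiffAt h2
      exact h4
    · rw [h13, ← hΦ.mem_iff _ (Φ.map_target hlT'.1), Φ.right_inv hlT'.1]
      exact (Λ.symm (w.1, c w.2)).2
    · rw [h13]
      exact c.injOn hlT'.2.2 hw.1.2 h12
  · obtain ⟨B, hB, hBΛ⟩ := isOpen_induced_iff.1 Λ.open_source
    have hzB : Φ z₀ ∈ B := by
      have : l₀ ∈ ((↑) : L → Euc n × Euc q) ⁻¹' B := by rw [hBΛ]; exact hlΛ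
      exact this
    filter_upwards [Φ.open_source.mem_nhds hzΦ,
      (Φ.continuousAt hzΦ).eventually (hB.mem_nhds hzB)] with z hz hzB' hzΓ
    have hl : (⟨Φ z, (hΦ.mem_iff _ hz).2 hzΓ⟩ : L) ∈ Λ.source := by
      rw [← hBΛ]
      exact hzB'
    have h1 : Λ ⟨Φ z, (hΦ.mem_iff _ hz).2 hzΓ⟩ = (z.1, c (ρ z)) := by
      rw [hΛ]
      simp only [hΘ, hP, Φ.left_inv hz]
    change (P (Λ.symm (z.1, c (ρ z)))).2 = z.2
    rw [← h1, Λ.left_inv hl]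
    simp only [hP, Φ.left_inv hz]

/-- If the fibre over `u₀` of a proper family `Γ` of submanifolds is parametrized by `M`, with inverse
`ρ`, then so are the nearby fibres. -/
theorem exists_smooth_section (hΓ : IsClosed Γ) {K : Set (Euc q)} (hK : IsCompact K)
    (hΓK : ∀ z ∈ Γ, z.2 ∈ K) (hsub : IsSubmanifold (n + d) Γ)
    (hsubm : ∀ z ∈ Γ, ∀ u : Euc n, ∃ v ∈ tangentVectors Γ z, v.1 = u)
    (hN : IsOpen N) (hρ : ContMDiffOn 𝓘(ℝ, Euc n × Euc q) (𝓡 d) ∞ ρ N)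
    (hφ : ContMDiff (𝓡 d) (𝓡 q) ∞ φ) (hφΓ : ∀ m, (u₀, φ m) ∈ Γ) (hφN : ∀ m, (u₀, φ m) ∈ N)
    (hρφ : ∀ m, ρ (u₀, φ m) = m) (hΓφ : ∀ x, (u₀, x) ∈ Γ → ∃ m, φ m = x) :
    ∃ U : Set (Euc n), IsOpen U ∧ u₀ ∈ U ∧ ∃ s : Euc n × M → Euc q,
      ContMDiffOn ((𝓡 n).prod (𝓡 d)) (𝓡 q) ∞ s (U ×ˢ univ) ∧
      ∀ u ∈ U, (∀ m, (u, s (u, m)) ∈ Γ ∧ ρ (u, s (u, m)) = m) ∧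
        ∀ x, (u, x) ∈ Γ → (u, x) ∈ N ∧ s (u, ρ (u, x)) = x := by
  classical
  -- Tube argument over the compact `K`: a point of the fibre over `u₀` has a neighbourhood in `N`,
  -- any other point one that misses the closed set `Γ`.
  have hN₁ : ∀ᶠ u in 𝓝 u₀, ∀ x ∈ K, (u, x) ∈ Γ → (u, x) ∈ N := by
    refine hK.eventually_forall_of_forall_eventually fun x _ ↦ ?_
    by_cases hx : (u₀, x) ∈ Γ
    · obtain ⟨m, rfl⟩ := hΓφ x hx
      filter_upwards [hN.mem_nhds (hφN m)] with z hz _ using hz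
    · filter_upwards [hΓ.isOpen_compl.mem_nhds hx] with z hz h using absurd h hz
  choose σ hσ hσΓ using exists_local_section hsub hsubm hN hρ hφ hφΓ hφN hρφ
  -- Near `(u₀, m₀)` the local section gives the only solution in `K`: near `φ m₀` by its
  -- construction, near another `φ m` because `ρ` is close to `m ≠ m₀`, and elsewhere because `Γ` is
  -- closed.
  have huniq : ∀ m₀ : M, ∀ᶠ w : Euc n × M in 𝓝 (u₀, m₀), ∀ x ∈ K,
      (w.1, x) ∈ Γ → ρ (w.1, x) = w.2 → x = σ m₀ w := by
    intro m₀
    refine hK.eventually_forall_of_forall_eventually fun x _ ↦ ?_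
    have hpr : Continuous fun p : (Euc n × M) × Euc q ↦ (p.1.1, p.2) := by fun_prop
    by_cases hx : (u₀, x) ∈ Γ
    · obtain ⟨m, rfl⟩ := hΓφ x hx
      by_cases hm : m = m₀
      · subst hm
        filter_upwards [(hpr.tendsto ((u₀, m), φ m)).eventually (hσΓ m)] with p hp h1 h2
        have := hp h1
        rw [h2] at this
        exact this.symm
      · have hρc : ContinuousAt ρ (u₀, φ m) := hρ.continuousOn.continuousAt (hN.mem_nhds (hφN m))
        have h1 : Tendsto (fun p : (Euc n × M) × Euc q ↦ (ρ (p.1.1, p.2), p.1.2))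
            (𝓝 ((u₀, m₀), φ m)) (𝓝 (m, m₀)) := by
          refine Tendsto.prodMk_nhds ?_ ?_
          · have := hρc.tendsto.comp (hpr.tendsto ((u₀, m₀), φ m))
            rwa [hρφ] at this
          · exact (continuous_snd.comp continuous_fst).tendsto ((u₀, m₀), φ m)
        filter_upwards [h1.eventually (isClosed_diagonal.isOpen_compl.mem_nhds (by simpa using hm))]
          with p hp _ h2
        exact absurd h2 hp
    · filter_upwards [(hpr.tendsto ((u₀, m₀), x)).eventually (hΓ.isOpen_compl.mem_nhds hx)]
        with p hp h using absurd h hp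
  -- By local uniqueness this arbitrary choice agrees with `σ m₀` near `(u₀, m₀)`, which makes it
  -- smooth there. The default `0` is not taken over the final `U`.
  set s : Euc n × M → Euc q := fun w ↦
    if h : ∃ x, (w.1, x) ∈ Γ ∧ ρ (w.1, x) = w.2 then h.choose else 0 with hs
  have hloc : ∀ m₀ : M, ∀ᶠ w : Euc n × M in 𝓝 (u₀, m₀),
      ContMDiffAt ((𝓡 n).prod (𝓡 d)) (𝓡 q) ∞ s w ∧ (w.1, s w) ∈ Γ ∧ ρ (w.1, s w) = w.2 ∧
      ∀ x, (w.1, x) ∈ Γ → ρ (w.1, x) = w.2 → s w = x := by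
    intro m₀
    have h1 : ∀ᶠ w : Euc n × M in 𝓝 (u₀, m₀), s w = σ m₀ w := by
      filter_upwards [hσ m₀, huniq m₀] with w hw1 hw2
      have hex : ∃ x, (w.1, x) ∈ Γ ∧ ρ (w.1, x) = w.2 := ⟨_, hw1.2⟩
      simp only [hs, dif_pos hex]
      exact hw2 _ (hΓK _ hex.choose_spec.1) hex.choose_spec.1 hex.choose_spec.2
    filter_upwards [eventually_eventually_nhds.2 h1, hσ m₀, huniq m₀] with w hw hw1 hw2
    have hsw : s w = σ m₀ w := hw.self_of_nhds
    refine ⟨hw1.1.congr_of_eventuallyEq hw, ?_, ?_, fun x hx hx' ↦ ?_⟩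
    · rw [hsw]; exact hw1.2.1
    · rw [hsw]; exact hw1.2.2
    · rw [hsw]; exact (hw2 x (hΓK _ hx) hx hx').symm
  have hall := isCompact_univ.eventually_forall_of_forall_eventually
    (P := fun (u : Euc n) (m : M) ↦
      ContMDiffAt ((𝓡 n).prod (𝓡 d)) (𝓡 q) ∞ s (u, m) ∧ (u, s (u, m)) ∈ Γ ∧ ρ (u, s (u, m)) = m ∧
      ∀ x, (u, x) ∈ Γ → ρ (u, x) = m → s (u, m) = x) (fun m₀ _ ↦ hloc m₀)
  obtain ⟨U, hU, hUo, hu₀⟩ := eventually_nhds_iff.1 (hall.and hN₁)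
  refine ⟨U, hUo, hu₀, s, fun w hw ↦ ((hU w.1 hw.1).1 w.2 (mem_univ _)).1.contMDiffWithinAt,
    fun u hu ↦ ⟨fun m ↦ ?_, fun x hx ↦ ⟨?_, ?_⟩⟩⟩
  · exact ⟨((hU u hu).1 m (mem_univ _)).2.1, ((hU u hu).1 m (mem_univ _)).2.2.1⟩
  · exact (hU u hu).2 x (hΓK _ hx) hx
  · exact ((hU u hu).1 _ (mem_univ _)).2.2.2 x hx rfl

end Sections

/-! ### Compact families of embeddings and diffeomorphisms -/

section Families

variable {d n q : ℕ} {M : CompactManifold d} {E F : Type*} [NormedAddCommGroup E] [NormedSpace ℝ E]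
  [NormedAddCommGroup F] [InnerProductSpace ℝ F]

/-- An injective smooth map with smooth local left inverses is an embedding. -/
theorem IsSmoothEmb.of_local_leftInverse {f : M → E} (hf : ContMDiff (𝓡 d) 𝓘(ℝ, E) ∞ f)
    (hinj : Function.Injective f)
    (h : ∀ m, ∃ r : E → M, ContMDiffAt 𝓘(ℝ, E) (𝓡 d) ∞ r (f m) ∧ ∀ᶠ m' in 𝓝 m, r (f m') = m') :
    IsSmoothEmb (𝓡 d) f where
  contMDiff := hf
  isEmbedding := (hf.continuous.isClosedEmbedding hinj).isEmbedding
  injective_mfderiv m := by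
    obtain ⟨r, hr, hrf⟩ := h m
    have h1 := (hr.mdifferentiableAt (by simp)).hasMFDerivAt
    have h2 := (hf.mdifferentiableAt (x := m) (by simp)).hasMFDerivAt
    have h3 := h1.comp m h2
    have h4 : HasMFDerivAt (𝓡 d) (𝓡 d) (r ∘ f) m (ContinuousLinearMap.id ℝ (TangentSpace (𝓡 d) m)) := by
      exact (hasMFDerivAt_id m).congr_of_eventuallyEq hrf
    have h5 := hasMFDerivAt_unique h3 h4
    intro v w hvw
    have h6 := congrArg (fun T : TangentSpace (𝓡 d) m →L[ℝ] TangentSpace (𝓡 d) m ↦ T v) h5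
    have h7 := congrArg (fun T : TangentSpace (𝓡 d) m →L[ℝ] TangentSpace (𝓡 d) m ↦ T w) h5
    have h8 : mfderiv 𝓘(ℝ, E) (𝓡 d) r (f m) (mfderiv (𝓡 d) 𝓘(ℝ, E) f m v) = v := h6
    have h9 : mfderiv 𝓘(ℝ, E) (𝓡 d) r (f m) (mfderiv (𝓡 d) 𝓘(ℝ, E) f m w) = w := h7
    rw [← h8, ← h9, hvw]

/-- A smooth map with a smooth left inverse is an embedding. -/
theorem IsSmoothEmb.of_leftInverse {f : M → E} (hf : ContMDiff (𝓡 d) 𝓘(ℝ, E) ∞ f) {O : Set E}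
    (hO : IsOpen O) {r : E → M} (hr : ContMDiffOn 𝓘(ℝ, E) (𝓡 d) ∞ r O) (hfO : ∀ m, f m ∈ O)
    (hrf : ∀ m, r (f m) = m) : IsSmoothEmb (𝓡 d) f :=
  .of_local_leftInverse hf (Function.LeftInverse.injective hrf) fun m ↦
    ⟨r, hr.contMDiffAt (hO.mem_nhds (hfO m)), .of_forall hrf⟩

/-- A retraction onto the image is the smooth extension of the inverse that the definition demands.
-/
theorem IsSmoothEmb.isDiffeomorphicTo_range [FiniteDimensional ℝ F] {f : M → F}
    (hf : IsSmoothEmb (𝓡 d) f) : IsDiffeomorphicTo M (range f) := by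
  refine ⟨Equiv.ofInjective f hf.isEmbedding.injective, hf.contMDiff, ?_⟩
  rintro ⟨_, m, rfl⟩
  have : Nonempty M := ⟨m⟩
  obtain ⟨O, r, hO, hr, hrf⟩ := hf.exists_retraction
  refine ⟨O, r, hO, (hrf m).1, hr, ?_⟩
  rintro ⟨_, m', rfl⟩ -
  rw [(hrf m').2]
  exact ((Equiv.ofInjective f hf.isEmbedding.injective).symm_apply_apply m').symm

theorem IsDiffeomorphicTo.exists_isSmoothEmb {W : Set E} (h : IsDiffeomorphicTo M W) :
    ∃ f : M → E, IsSmoothEmb (𝓡 d) f ∧ range f = W := by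
  obtain ⟨e, he, her⟩ := h
  refine ⟨fun m ↦ e m, ?_, ?_⟩
  · refine .of_local_leftInverse he (Subtype.val_injective.comp e.injective) fun m ↦ ?_
    obtain ⟨O, r, hO, hmO, hr, hre⟩ := her (e m)
    refine ⟨r, hr.contMDiffAt (hO.mem_nhds hmO), ?_⟩
    filter_upwards [he.continuous.continuousAt.eventually (hO.mem_nhds hmO)] with m' hm'
    rw [hre _ hm', e.symm_apply_apply]
  · exact (range_comp ((↑) : W → E) e).trans (by simp)

/-- Compact manifolds embedded with the same image are diffeomorphic. -/
theorem IsSmoothEmb.exists_diffeomorph [FiniteDimensional ℝ F] {M' : CompactManifold d}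
    {f : M → F} {f' : M' → F} (hf : IsSmoothEmb (𝓡 d) f) (hf' : IsSmoothEmb (𝓡 d) f')
    (h : range f = range f') : ∃ k : M ≃ₘ^∞⟮𝓡 d, 𝓡 d⟯ M', ∀ x, f' (k x) = f x := by
  -- The transition map is `r ∘ g`, where `r` is a retraction with `r ∘ g' = id`; exchanging the
  -- roles gives a smooth inverse.
  have key : ∀ {N N' : CompactManifold d} {g : N → F} {g' : N' → F}, IsSmoothEmb (𝓡 d) g →
      IsSmoothEmb (𝓡 d) g' → range g = range g' →
      ∃ k : N → N', ContMDiff (𝓡 d) (𝓡 d) ∞ k ∧ ∀ x, g' (k x) = g x := by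
    intro N N' g g' hg hg' h
    have hk : ∀ x, ∃ y, g' y = g x := fun x ↦ by
      have := mem_range_self (f := g) x
      rwa [h] at this
    choose k hk using hk
    refine ⟨k, fun x ↦ ?_, hk⟩
    have : Nonempty N' := ⟨k x⟩
    obtain ⟨O, r, hO, hr, hrf⟩ := hg'.exists_retraction
    have h1 : k = r ∘ g := funext fun x ↦ by rw [Function.comp_apply, ← hk, (hrf _).2]
    rw [h1]
    exact (hr.contMDiffAt (hO.mem_nhds (by rw [← hk]; exact (hrf _).1))).comp x (hg.contMDiff x)
  obtain ⟨k, hk, hkf⟩ := key hf hf' h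
  obtain ⟨k', hk', hkf'⟩ := key hf' hf h.symm
  exact ⟨{
    toFun := k
    invFun := k'
    left_inv := fun x ↦ hf.isEmbedding.injective (by rw [hkf', hkf])
    right_inv := fun x ↦ hf'.isEmbedding.injective (by rw [hkf, hkf'])
    contMDiff_toFun := hk
    contMDiff_invFun := hk' }, hkf⟩

/-- A smooth family of embeddings of a compact manifold is an embedding over `ℝⁿ`. -/
theorem IsSmoothEmb.family [FiniteDimensional ℝ E] {f : Euc n × M → E}
    (hf : ContMDiff ((𝓡 n).prod (𝓡 d)) 𝓘(ℝ, E) ∞ f)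
    (hu : ∀ u, IsSmoothEmb (𝓡 d) (fun m : M ↦ f (u, m))) :
    IsSmoothEmb ((𝓡 n).prod (𝓡 d)) (fun z : Euc n × M ↦ (z.1, f z)) where
  contMDiff := contMDiff_fst.prodMk_space hf
  isEmbedding := by
    refine (Topology.IsClosedEmbedding.of_continuous_injective_isClosedMap ?_ ?_ ?_).isEmbedding
    · exact continuous_fst.prodMk hf.continuous
    · rintro ⟨u, m⟩ ⟨u', m'⟩ h
      obtain ⟨h1, h2⟩ := Prod.ext_iff.1 h
      have h1' : u = u' := h1
      subst h1'
      exact Prod.ext rfl ((hu u).isEmbedding.injective h2)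
    · intro C hC
      -- The image of `C` is the projection of this closed set along the compact factor `M`, hence
      -- closed.
      have hcl : IsClosed {p : (Euc n × E) × M | (p.1.1, p.2) ∈ C ∧ f (p.1.1, p.2) = p.1.2} := by
        have h1 : Continuous fun p : (Euc n × E) × M ↦ (p.1.1, p.2) := by fun_prop
        exact (hC.preimage h1).inter
          (isClosed_eq (hf.continuous.comp h1) (continuous_snd.comp continuous_fst))
      refine Eq.mpr (congrArg IsClosed (Set.ext ?_)) (isClosedMap_fst_of_compactSpace _ hcl)
      rintro ⟨u, x⟩
      constructor
      · rintro ⟨⟨u', m⟩, hm, h⟩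
        obtain ⟨h1, h2⟩ := Prod.ext_iff.1 h
        have h1' : u' = u := h1
        subst h1'
        exact ⟨((u', x), m), ⟨hm, h2⟩, rfl⟩
      · rintro ⟨⟨⟨u', x'⟩, m⟩, ⟨hm, h2⟩, h⟩
        obtain ⟨h3, h4⟩ := Prod.ext_iff.1 h
        have h3' : u' = u := h3
        have h4' : x' = x := h4
        subst h3' h4'
        exact ⟨(u', m), hm, Prod.ext rfl h2⟩
  injective_mfderiv z := by
    have hF : MDifferentiableAt ((𝓡 n).prod (𝓡 d)) 𝓘(ℝ, Euc n × E)
        (fun z : Euc n × M ↦ (z.1, f z)) z :=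
      (contMDiff_fst.prodMk_space hf).mdifferentiableAt (by simp)
    have hfz : MDifferentiableAt ((𝓡 n).prod (𝓡 d)) 𝓘(ℝ, E) f z :=
      hf.mdifferentiableAt (by simp)
    have h1 := (ContinuousLinearMap.fst ℝ (Euc n) E).hasMFDerivAt.comp z hF.hasMFDerivAt
    have h2 := (ContinuousLinearMap.snd ℝ (Euc n) E).hasMFDerivAt.comp z hF.hasMFDerivAt
    have h3 := hasMFDerivAt_unique h1 (hasMFDerivAt_fst (I := 𝓡 n) (I' := 𝓡 d) z)
    have h4 := hasMFDerivAt_unique h2 hfz.hasMFDerivAt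
    -- The derivative is block triangular: the projection to `ℝⁿ` kills `v.1`, and what remains is
    -- the derivative of a single embedding at `v.2`.
    refine (injective_iff_map_eq_zero _).2 fun v hv ↦ ?_
    have h5 : v.1 = 0 := by
      have := congrArg (fun T : (Euc n × Euc d) →L[ℝ] Euc n ↦ T v) h3
      refine Eq.trans this.symm ?_
      change (mfderiv ((𝓡 n).prod (𝓡 d)) 𝓘(ℝ, Euc n × E) (fun z : Euc n × M ↦ (z.1, f z)) z v).1 = 0
      rw [hv]
      rfl
    have h6 : mfderiv ((𝓡 n).prod (𝓡 d)) 𝓘(ℝ, E) f z v = 0 := by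
      have := congrArg (fun T : (Euc n × Euc d) →L[ℝ] E ↦ T v) h4
      refine Eq.trans this.symm ?_
      change (mfderiv ((𝓡 n).prod (𝓡 d)) 𝓘(ℝ, Euc n × E) (fun z : Euc n × M ↦ (z.1, f z)) z v).2 = 0
      rw [hv]
      rfl
    have h8 : mfderiv (𝓡 n) 𝓘(ℝ, E) (fun u ↦ f (u, z.2)) z.1 v.1 = 0 :=
      (congrArg _ h5).trans (map_zero _)
    rw [mfderiv_prod_eq_add_apply hfz] at h6
    have h9 : ∀ a b : E, a + b = 0 → a = 0 → b = 0 := by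
      rintro a b h rfl
      simpa using h
    have h7 := (injective_iff_map_eq_zero _).1 ((hu z.1).injective_mfderiv z.2) v.2 (h9 _ _ h6 h8)
    exact Prod.ext h5 h7

/-- A plot of embeddings is a jointly smooth family. -/
theorem Emb.isPlot_iff {p : ℕ} {f : Euc n → Emb M p} :
    Emb.IsPlot M p n f ↔
      ContMDiff ((𝓡 n).prod (𝓡 d)) (𝓡 p) ∞ (fun z : Euc n × M ↦ (f z.1).1 z.2) := by
  constructor
  · intro h
    exact (contDiff_snd (𝕜 := ℝ) (E := Euc n) (F := Euc p)).contMDiff.comp h.contMDiff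
  · exact fun h ↦ IsSmoothEmb.family h fun u ↦ (f u).2.1

theorem isClosed_range_family [FiniteDimensional ℝ E] {f : Euc n × M → E} (hf : Continuous f) :
    IsClosed (range fun z : Euc n × M ↦ (z.1, f z)) := by
  have hcl : IsClosed {p : (Euc n × E) × M | f (p.1.1, p.2) = p.1.2} :=
    isClosed_eq (hf.comp (by fun_prop)) (continuous_snd.comp continuous_fst)
  convert isClosedMap_fst_of_compactSpace _ hcl using 1
  ext ⟨u, x⟩
  constructor
  · rintro ⟨⟨u', m⟩, h⟩
    obtain ⟨h1, h2⟩ := Prod.ext_iff.1 h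
    have h1' : u' = u := h1
    subst h1'
    exact ⟨((u', x), m), h2, rfl⟩
  · rintro ⟨⟨⟨u', x'⟩, m⟩, h2, h⟩
    obtain ⟨h3, h4⟩ := Prod.ext_iff.1 h
    have h3' : u' = u := h3
    have h4' : x' = x := h4
    subst h3' h4'
    exact ⟨(u', m), Prod.ext rfl h2⟩

/-- The image of a smooth family of embeddings is a family of submanifolds submersed over `ℝⁿ`. -/
theorem submersion_range_family [FiniteDimensional ℝ E] {f : Euc n × M → E}
    (hf : ContMDiff ((𝓡 n).prod (𝓡 d)) 𝓘(ℝ, E) ∞ f)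
    (hu : ∀ u, IsSmoothEmb (𝓡 d) (fun m : M ↦ f (u, m))) :
    IsSubmanifold (n + d) (range fun z : Euc n × M ↦ (z.1, f z)) ∧
    ∀ z ∈ range (fun z : Euc n × M ↦ (z.1, f z)), ∀ u : Euc n,
      ∃ v ∈ tangentVectors (range fun z : Euc n × M ↦ (z.1, f z)) z, v.1 = u := by
  have hsub : IsSubmanifold (n + d) (range fun z : Euc n × M ↦ (z.1, f z)) := by
    have := (IsSmoothEmb.family hf hu).isSubmanifold_range
    simpa using this
  refine ⟨hsub, ?_⟩
  rintro _ ⟨z, rfl⟩ a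
  obtain ⟨L, Φ, hz, hL, hΦ⟩ := hsub _ ⟨z, rfl⟩
  have h1 : ContDiff ℝ ∞ fun u : Euc n ↦ (u, f (u, z.2)) :=
    contDiff_id.prodMk (contMDiff_iff_contDiff.1
      (hf.comp (contMDiff_id.prodMk contMDiff_const)))
  have h2 := ((h1.differentiable (by simp)) z.1).hasFDerivAt
  refine ⟨_, ⟨L, Φ, hz, hΦ, hΦ.fderiv_mem h2 hz (.of_forall fun u ↦ ⟨(u, z.2), rfl⟩) a⟩, ?_⟩
  have h3 := (hasFDerivAt_fst (𝕜 := ℝ) (E := Euc n) (F := E) (p := (z.1, f z))).comp z.1 h2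
  exact congrArg (fun T : Euc n →L[ℝ] Euc n ↦ T a) (h3.unique (hasFDerivAt_id z.1))

theorem exists_isSmoothEmb (M : CompactManifold d) :
    ∃ (p : ℕ) (φ : M → Euc p), IsSmoothEmb (𝓡 d) φ := by
  obtain ⟨p, e, h1, h2, h3⟩ := exists_embedding_euclidean_of_compact (I := 𝓡 d) (M := M)
  exact ⟨p, e, h1, h2.isEmbedding, h3⟩

/-- The inverses of a smooth family of diffeomorphisms form a smooth family. -/
theorem contMDiffOn_symm_family {U : Set (Euc n)} (hU : IsOpen U) {g h : Euc n × M → M}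
    (hg : ContMDiffOn ((𝓡 n).prod (𝓡 d)) (𝓡 d) ∞ g (U ×ˢ univ))
    (hh : ∀ u ∈ U, ContMDiff (𝓡 d) (𝓡 d) ∞ fun m ↦ h (u, m))
    (hgh : ∀ u ∈ U, ∀ m, g (u, h (u, m)) = m) (hhg : ∀ u ∈ U, ∀ m, h (u, g (u, m)) = m) :
    ContMDiffOn ((𝓡 n).prod (𝓡 d)) (𝓡 d) ∞ h (U ×ˢ univ) := by
  rintro ⟨u₀, m₀⟩ ⟨hu₀, -⟩
  have : Nonempty M := ⟨m₀⟩
  have hu₀' : u₀ ∈ U := hu₀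
  obtain ⟨q, φ, hφ⟩ := exists_isSmoothEmb M
  obtain ⟨O, r, hO, hr, hrφ⟩ := hφ.exists_retraction
  -- The section theorem is applied to the constant family `ℝⁿ × φ(M)` with `ρ (u, x) = g (u, r x)`,
  -- whose section is `φ ∘ h`. Retracting by `r` yields joint smoothness of `h` from smoothness in
  -- each fibre.
  have hfam : ContMDiff ((𝓡 n).prod (𝓡 d)) (𝓡 q) ∞ fun z : Euc n × M ↦ φ z.2 :=
    hφ.contMDiff.comp contMDiff_snd
  obtain ⟨hsub, hsubm⟩ := submersion_range_family hfam fun _ ↦ hφ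
  have hΓ := isClosed_range_family hfam.continuous
  set Γ := range fun z : Euc n × M ↦ (z.1, φ z.2) with hΓd
  have hmem : ∀ u m, (u, φ m) ∈ Γ := fun u m ↦ ⟨(u, m), rfl⟩
  set ρ : Euc n × Euc q → M := fun z ↦ g (z.1, r z.2) with hρ
  have hρs : ContMDiffOn 𝓘(ℝ, Euc n × Euc q) (𝓡 d) ∞ ρ (U ×ˢ O) := by
    refine hg.comp (contDiff_fst.contMDiff.contMDiffOn.prodMk
      (hr.comp contDiff_snd.contMDiff.contMDiffOn fun z hz ↦ hz.2)) fun z hz ↦ ⟨hz.1, mem_univ _⟩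
  obtain ⟨V, hV, huV, s, hs, hsV⟩ := exists_smooth_section (K := range φ) (M := M) hΓ
    (isCompact_range hφ.contMDiff.continuous) (by rintro _ ⟨z, rfl⟩; exact ⟨z.2, rfl⟩) hsub hsubm
    (hU.prod hO) hρs (u₀ := u₀) (φ := fun m ↦ φ (h (u₀, m)))
    (hφ.contMDiff.comp (hh u₀ hu₀)) (fun m ↦ hmem _ _) (fun m ↦ ⟨hu₀, (hrφ _).1⟩)
    (fun m ↦ by simp only [hρ, (hrφ _).2, hgh u₀ hu₀'])
    (by
      rintro x ⟨⟨u, m⟩, hx⟩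
      obtain ⟨rfl, rfl⟩ := Prod.ext_iff.1 hx
      exact ⟨g (u, m), by simp only [hhg u hu₀']⟩)
  have heq : ∀ u ∈ U ∩ V, ∀ m, s (u, m) = φ (h (u, m)) := by
    intro u hu m
    have := ((hsV u hu.2).2 (φ (h (u, m))) (hmem _ _)).2
    simpa only [hρ, (hrφ _).2, hgh u hu.1] using this
  have hev : ∀ᶠ w : Euc n × M in 𝓝 (u₀, m₀), h w = r (s w) := by
    filter_upwards [((hU.inter hV).prod isOpen_univ).mem_nhds ⟨⟨hu₀', huV⟩, mem_univ _⟩] with w hw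
    rw [heq w.1 hw.1, (hrφ _).2]
  refine (ContMDiffAt.congr_of_eventuallyEq ?_ hev).contMDiffWithinAt
  refine ContMDiffAt.comp (u₀, m₀) (g := r) (I' := 𝓡 q) ?_
    (hs.contMDiffAt ((hV.prod isOpen_univ).mem_nhds ⟨huV, mem_univ _⟩))
  rw [heq u₀ ⟨hu₀', huV⟩]
  exact hr.contMDiffAt (hO.mem_nhds (hrφ _).1)

end Families

/-! ### A submanifold as an abstract manifold -/

section SubmanifoldCharts

variable {d : ℕ} {E : Type*} [NormedAddCommGroup E] [NormedSpace ℝ E]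
  {W : Set E}

/-- A slice chart whose linear subspace is parametrized by `ℝᵈ`. -/
structure SliceParam (d : ℕ) (W : Set E) where
  L : Submodule ℝ E
  Φ : OpenPartialHomeomorph E E
  isSliceChart : IsSliceChart W L Φ
  incl : Euc d →L[ℝ] E
  proj : E →L[ℝ] Euc d
  incl_mem : ∀ y, incl y ∈ L
  proj_incl : ∀ y, proj (incl y) = y
  incl_proj : ∀ l ∈ L, incl (proj l) = l

theorem IsSubmanifold.exists_sliceParam [FiniteDimensional ℝ E] (h : IsSubmanifold d W) {x : E} (hx : x ∈ W) :
    ∃ S : SliceParam d W, x ∈ S.Φ.source := by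
  obtain ⟨L, Φ, hxΦ, hL, hΦ⟩ := h x hx
  let ℓ : L ≃L[ℝ] Euc d := ContinuousLinearEquiv.ofFinrankEq (by simp [hL])
  obtain ⟨P, hP⟩ := L.exists_isCompl
  let π : E →L[ℝ] L := LinearMap.toContinuousLinearMap (L.projectionOnto P hP)
  have hπ : ∀ l (hl : l ∈ L), π l = ⟨l, hl⟩ := fun l hl ↦
    Submodule.projectionOnto_apply_left hP ⟨l, hl⟩
  refine ⟨⟨L, Φ, hΦ, L.subtypeL.comp (ℓ.symm : Euc d →L[ℝ] L), (ℓ : L →L[ℝ] Euc d).comp π, fun y ↦ (ℓ.symm y).2,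
    fun y ↦ ?_, fun l hl ↦ ?_⟩, hxΦ⟩
  · simp [hπ]
  · simp [hπ l hl]

open Classical in
/-- The chart of a submanifold defined by a slice chart. -/
def SliceParam.chart (S : SliceParam d W) (x : W) : OpenPartialHomeomorph W (Euc d) where
  toFun w := S.proj (S.Φ w)
  -- The point `x` serves only as a value off the target.
  invFun y := if h : S.Φ.symm (S.incl y) ∈ W then ⟨S.Φ.symm (S.incl y), h⟩ else x
  source := (↑) ⁻¹' S.Φ.source
  target := S.incl ⁻¹' S.Φ.target
  map_source' w hw := by
    have h1 := (S.isSliceChart.mem_iff _ hw).2 w.2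
    simpa [S.incl_proj _ h1] using S.Φ.map_source hw
  map_target' y hy := by
    have h1 : S.Φ.symm (S.incl y) ∈ W := by
      rw [← S.isSliceChart.mem_iff _ (S.Φ.map_target hy), S.Φ.right_inv hy]
      exact S.incl_mem y
    simpa [h1] using S.Φ.map_target hy
  left_inv' w hw := by
    have h1 := (S.isSliceChart.mem_iff _ hw).2 w.2
    have h2 : S.Φ.symm (S.incl (S.proj (S.Φ w))) = w := by
      rw [S.incl_proj _ h1, S.Φ.left_inv hw]
    simp [h2]
  right_inv' y hy := by
    have h1 : S.Φ.symm (S.incl y) ∈ W := by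
      rw [← S.isSliceChart.mem_iff _ (S.Φ.map_target hy), S.Φ.right_inv hy]
      exact S.incl_mem y
    simp [h1, S.Φ.right_inv hy, S.proj_incl]
  open_source := S.Φ.open_source.preimage continuous_subtype_val
  open_target := S.Φ.open_target.preimage S.incl.continuous
  continuousOn_toFun := S.proj.continuous.comp_continuousOn
    (S.Φ.continuousOn.comp continuous_subtype_val.continuousOn (mapsTo_preimage _ _))
  continuousOn_invFun := by
    rw [Topology.IsInducing.subtypeVal.continuousOn_iff]
    refine (S.Φ.continuousOn_symm.comp S.incl.continuous.continuousOn fun _ h ↦ h).congr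
      fun y hy ↦ ?_
    have h1 : S.Φ.symm (S.incl y) ∈ W := by
      rw [← S.isSliceChart.mem_iff _ (S.Φ.map_target hy), S.Φ.right_inv hy]
      exact S.incl_mem y
    simp [h1]

theorem SliceParam.coe_chart_symm (S : SliceParam d W) (x : W) {y : Euc d}
    (hy : S.incl y ∈ S.Φ.target) : ((S.chart x).symm y : E) = S.Φ.symm (S.incl y) := by
  have h1 : S.Φ.symm (S.incl y) ∈ W := by
    rw [← S.isSliceChart.mem_iff _ (S.Φ.map_target hy), S.Φ.right_inv hy]
    exact S.incl_mem y
  classical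
  change ((dite _ _ _ : W) : E) = _
  rw [dif_pos h1]

/-- The charts of a submanifold. -/
@[reducible]
def IsSubmanifold.chartedSpace [FiniteDimensional ℝ E] (h : IsSubmanifold d W) : ChartedSpace (Euc d) W where
  atlas := range fun x : W ↦ (h.exists_sliceParam x.2).choose.chart x
  chartAt x := (h.exists_sliceParam x.2).choose.chart x
  mem_chart_source x := (h.exists_sliceParam x.2).choose_spec
  chart_mem_atlas x := mem_range_self x

theorem IsSubmanifold.isManifold [FiniteDimensional ℝ E] (h : IsSubmanifold d W) :
    @IsManifold ℝ _ (Euc d) _ _ (Euc d) _ (𝓡 d) ∞ W _ h.chartedSpace := by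
  let _ := h.chartedSpace
  refine isManifold_of_contDiffOn (𝓡 d) ∞ W ?_
  rintro _ _ ⟨x, rfl⟩ ⟨x', rfl⟩
  set S := (h.exists_sliceParam x.2).choose
  set S' := (h.exists_sliceParam x'.2).choose
  simp only [modelWithCornersSelf_coe, modelWithCornersSelf_coe_symm, range_id, inter_univ,
    Function.id_comp, Function.comp_id, preimage_id]
  have hsrc : ∀ y ∈ ((S.chart x).symm.trans (S'.chart x')).source,
      S.incl y ∈ S.Φ.target ∧ S.Φ.symm (S.incl y) ∈ S'.Φ.source := by
    intro y hy
    rw [OpenPartialHomeomorph.trans_source] at hy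
    have h1 : S.incl y ∈ S.Φ.target := hy.1
    refine ⟨h1, ?_⟩
    rw [← S.coe_chart_symm x h1]
    exact hy.2
  have hsm : ContDiffOn ℝ ∞ (fun y ↦ S'.proj (S'.Φ (S.Φ.symm (S.incl y))))
      ((S.chart x).symm.trans (S'.chart x')).source :=
    S'.proj.contDiff.comp_contDiffOn (S'.isSliceChart.contDiffOn.comp
      (S.isSliceChart.contDiffOn_symm.comp S.incl.contDiff.contDiffOn fun y hy ↦ (hsrc y hy).1)
      fun y hy ↦ (hsrc y hy).2)
  refine hsm.congr fun y hy ↦ ?_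
  change S'.proj (S'.Φ ((S.chart x).symm y)) = _
  rw [S.coe_chart_symm x (hsrc y hy).1]

/-- A compact submanifold as an abstract manifold. -/
def IsSubmanifold.toCompactManifold {p : ℕ} {W : Set (Euc p)} (h : IsSubmanifold d W)
    (hW : IsCompact W) : CompactManifold d where
  carrier := W
  charted := h.chartedSpace
  smooth := h.isManifold
  compact := isCompact_iff_compactSpace.1 hW

/-- The identity of `W` is the diffeomorphism. In a chart the inclusion is `Φ.symm ∘ incl`, and its
inverse extends off `W` as the inverse chart after `proj ∘ Φ`. -/
theorem IsSubmanifold.isDiffeomorphicTo {p : ℕ} {W : Set (Euc p)} (h : IsSubmanifold d W)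
    (hW : IsCompact W) : IsDiffeomorphicTo (h.toCompactManifold hW) W := by
  let _ := h.chartedSpace
  have := h.isManifold
  have hchart : ∀ x : W, chartAt (Euc d) x = (h.exists_sliceParam x.2).choose.chart x :=
    fun x ↦ rfl
  refine ⟨Equiv.refl W, ?_, ?_⟩
  · change ContMDiff (𝓡 d) (𝓡 p) ∞ ((↑) : W → Euc p)
    intro x
    set S := (h.exists_sliceParam x.2).choose
    have hx : (x : Euc p) ∈ S.Φ.source := (h.exists_sliceParam x.2).choose_spec
    have hy := S.Φ.map_source hx
    have h1 : S.incl (S.proj (S.Φ x)) = S.Φ x :=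
      S.incl_proj _ ((S.isSliceChart.mem_iff _ hx).2 x.2)
    have h2 : ContDiffAt ℝ ∞ (fun y ↦ S.Φ.symm (S.incl y)) (S.proj (S.Φ x)) := by
      refine ContDiffAt.comp _ ?_ S.incl.contDiff.contDiffAt
      rw [h1]
      exact S.isSliceChart.contDiffOn_symm.contDiffAt (S.Φ.open_target.mem_nhds hy)
    have h3 : ContMDiffAt (𝓡 d) (𝓡 d) ∞ (fun w : W ↦ S.proj (S.Φ w)) x :=
      contMDiffAt_extChartAt (I := 𝓡 d) (x := x)
    have h4 := ContMDiffAt.comp (g := fun y ↦ S.Φ.symm (S.incl y)) x h2.contMDiffAt h3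
    refine h4.congr_of_eventuallyEq ?_
    filter_upwards [(chartAt (Euc d) x).open_source.mem_nhds (mem_chart_source _ x)] with w hw
    have hw' : (w : Euc p) ∈ S.Φ.source := hw
    simp only [Function.comp_apply]
    rw [S.incl_proj _ ((S.isSliceChart.mem_iff _ hw').2 w.2), S.Φ.left_inv hw']
  · rintro (x : W)
    set S := (h.exists_sliceParam x.2).choose with hS
    have hx : (x : Euc p) ∈ S.Φ.source := (h.exists_sliceParam x.2).choose_spec
    have h1 : S.incl (S.proj (S.Φ x)) = S.Φ x :=
      S.incl_proj _ ((S.isSliceChart.mem_iff _ hx).2 x.2)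
    have hf : ContDiffOn ℝ ∞ (fun y ↦ S.proj (S.Φ y)) S.Φ.source :=
      S.proj.contDiff.comp_contDiffOn S.isSliceChart.contDiffOn
    refine ⟨S.Φ.source ∩ (fun y ↦ S.proj (S.Φ y)) ⁻¹' (S.chart x).target,
      fun y ↦ (S.chart x).symm (S.proj (S.Φ y)), ?_, ?_, ?_, ?_⟩
    · exact hf.continuousOn.isOpen_inter_preimage S.Φ.open_source (S.chart x).open_target
    · exact ⟨hx, (S.chart x).map_source hx⟩
    · exact ContMDiffOn.comp (contMDiffOn_chart_symm (I := 𝓡 d) (n := ∞) (x := x))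
        (hf.mono inter_subset_left).contMDiffOn inter_subset_right
    · rintro (z : W) hz
      exact (S.chart x).left_inv hz.1

end SubmanifoldCharts

/-! ### Topologies determined by plots -/

section PlotSpaces

/-- The topology of `X` is the finest one making continuous a class of plots which contains the
points. -/
structure IsPlotSpace (X : Type*) [t : TopologicalSpace X] (P : ∀ n : ℕ, (Euc n → X) → Prop) :
    Prop where
  eq : t = plotTopology P
  const : ∀ x, P 0 fun _ ↦ x

variable {X Y Z : Type*} [TopologicalSpace X] [TopologicalSpace Y] [TopologicalSpace Z]
  {P : ∀ n : ℕ, (Euc n → X) → Prop} {Q : ∀ n : ℕ, (Euc n → Y) → Prop}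

namespace IsPlotSpace

theorem isOpen_iff (hX : IsPlotSpace X P) {A : Set X} :
    IsOpen A ↔ ∀ (n : ℕ) (f : Euc n → X), P n f → IsOpen (f ⁻¹' A) := by
  rw [← isOpen_plotTopology_iff, ← hX.eq]

theorem continuous_plot (hX : IsPlotSpace X P) {n : ℕ} {f : Euc n → X} (hf : P n f) :
    Continuous f :=
  continuous_def.2 fun _ hA ↦ hX.isOpen_iff.1 hA n f hf

theorem continuous_iff (hX : IsPlotSpace X P) {g : X → Z} :
    Continuous g ↔ ∀ (n : ℕ) (f : Euc n → X), P n f → Continuous (g ∘ f) := by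
  refine ⟨fun hg n f hf ↦ hg.comp (hX.continuous_plot hf), fun h ↦ continuous_def.2 fun A hA ↦ ?_⟩
  exact hX.isOpen_iff.2 fun n f hf ↦ hA.preimage (h n f hf)

theorem deltaGeneratedSpace (hX : IsPlotSpace X P) : DeltaGeneratedSpace X := by
  have h : ∀ n, DeltaGeneratedSpace (Euc n) := fun n ↦
    (EuclideanSpace.equiv (Fin n) ℝ).symm.toHomeomorph.isQuotientMap.isGeneratedBy
  obtain rfl := hX.eq
  refine Topology.IsGeneratedBy.iSup fun n ↦ Topology.IsGeneratedBy.iSup fun f ↦ ?_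
  have := h n
  exact Topology.IsGeneratedBy.coinduced f.1

/-- Constant plots give surjectivity. Presenting `X` as a quotient of a sum of Euclidean spaces is
what gives access to products. -/
theorem isQuotientMap (hX : IsPlotSpace X P) :
    Topology.IsQuotientMap
      fun z : Σ i : (Σ n : ℕ, {f : Euc n → X // P n f}), Euc i.1 ↦ z.1.2.1 z.2 := by
  refine (Topology.isQuotientMap_iff _).2 ⟨Topology.isCoinducing_iff.2 fun A ↦ ?_,
    fun x ↦ ⟨⟨⟨0, ⟨_, hX.const x⟩⟩, 0⟩, rfl⟩⟩
  rw [hX.isOpen_iff, isOpen_sigma_iff]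
  exact ⟨fun h n f hf ↦ h ⟨n, ⟨f, hf⟩⟩, fun h i ↦ h i.1 i.2.1 i.2.2⟩

/-- A quotient map stays a quotient map after taking the product with a locally compact space. -/
theorem continuous_prod (hX : IsPlotSpace X P) [LocallyCompactSpace Y] {g : X × Y → Z}
    (h : ∀ (n : ℕ) (f : Euc n → X), P n f → Continuous fun p : Euc n × Y ↦ g (f p.1, p.2)) :
    Continuous g := by
  refine hX.isQuotientMap.continuous_lift_prod_left ?_
  refine (Homeomorph.sigmaProdDistrib (Y := Y)).symm.isQuotientMap.continuous_iff.2 ?_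
  exact continuous_sigma fun i ↦ h i.1 i.2.1 i.2.2

/-- The test maps `c : ℝⁱ → X × Y` are merely continuous, so their components need not be plots.
Their source is locally compact, however, and two uses of `continuous_prod` replace first one
coordinate and then the other by a plot, before restricting to the graph of `c`. -/
theorem continuous_deltaProd (hX : IsPlotSpace X P) (hY : IsPlotSpace Y Q) {g : X × Y → Z}
    (h : ∀ (n m : ℕ) (f : Euc n → X) (k : Euc m → Y), P n f → Q m k →
      Continuous fun p : Euc n × Euc m ↦ g (f p.1, k p.2)) :
    Continuous fun z : DeltaProd X Y ↦ g z.pair := by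
  rw [Topology.WithGeneratedByTopology.continuous_from_iff]
  intro i c
  have h1 : ∀ (n : ℕ) (f : Euc n → X), P n f →
      Continuous fun p : Y × Euc n ↦ g (f p.2, p.1) := by
    intro n f hf
    refine hY.continuous_prod fun m k hk ↦ ?_
    exact (h n m f k hf hk).comp continuous_swap
  have h2 : Continuous fun p : X × (Fin i → ℝ) ↦ g (p.1, (c p.2).2) := by
    refine hX.continuous_prod fun n f hf ↦ ?_
    exact (h1 n f hf).comp
      ((continuous_snd.comp (c.continuous.comp continuous_snd)).prodMk continuous_fst)
  exact h2.comp ((continuous_fst.comp c.continuous).prodMk continuous_id)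

/-- Plots are defined on all of `ℝⁿ`, so a map that is good only near `u₀` is precomposed with a
smooth parametrization of a small ball by `ℝⁿ`, which carries `𝓝 0` to `𝓝 u₀`. -/
theorem continuousAt (hX : IsPlotSpace X P) {n : ℕ} {h : Euc n → X} {U : Set (Euc n)} {u₀ : Euc n}
    (hU : U ∈ 𝓝 u₀)
    (hP : ∀ κ : Euc n → Euc n, ContDiff ℝ ∞ κ → (∀ v, κ v ∈ U) → P n (h ∘ κ)) :
    ContinuousAt h u₀ := by
  obtain ⟨ε, hε, hεU⟩ := Metric.mem_nhds_iff.1 hU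
  set κ := OpenPartialHomeomorph.univBall u₀ ε with hκ
  have hκ0 : κ 0 = u₀ := OpenPartialHomeomorph.univBall_apply_zero u₀ ε
  have hsrc : κ.source = univ := OpenPartialHomeomorph.univBall_source u₀ ε
  have hmap : ∀ v, κ v ∈ U := fun v ↦ hεU <| by
    rw [← OpenPartialHomeomorph.univBall_target u₀ hε]
    exact κ.map_source (by rw [hsrc]; trivial)
  have hc := hX.continuous_plot (hP κ OpenPartialHomeomorph.contDiff_univBall hmap)
  have hmapnhds : map κ (𝓝 0) = 𝓝 u₀ := by
    rw [κ.map_nhds_eq (by rw [hsrc]; trivial), hκ0]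
  rw [ContinuousAt, ← hmapnhds, tendsto_map'_iff, ← hκ0]
  exact hc.tendsto 0

theorem continuousOn (hX : IsPlotSpace X P) {O : Set X} (hO : IsOpen O) {g : X → Z}
    (h : ∀ (n : ℕ) (f : Euc n → X), P n f → ∀ u, f u ∈ O → ContinuousAt (g ∘ f) u) :
    ContinuousOn g O := by
  rw [continuousOn_open_iff hO]
  intro A hA
  rw [hX.isOpen_iff]
  intro n f hf
  rw [isOpen_iff_mem_nhds]
  rintro u ⟨hu, huA⟩
  filter_upwards [(hX.continuous_plot hf).continuousAt.eventually (hO.mem_nhds hu),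
    (h n f hf u hu).eventually (hA.mem_nhds huA)] with v h1 h2 using ⟨h1, h2⟩

theorem isOpen_of_eventually (hX : IsPlotSpace X P) {A : Set X}
    (h : ∀ (n : ℕ) (f : Euc n → X), P n f → ∀ u, f u ∈ A → ∀ᶠ v in 𝓝 u, f v ∈ A) : IsOpen A := by
  rw [hX.isOpen_iff]
  intro n f hf
  rw [isOpen_iff_mem_nhds]
  exact fun u hu ↦ h n f hf u hu

/-- A jointly plotted family over `ℝⁿ × ℝᵐ` is continuous. -/
theorem continuous_of_prod (hX : IsPlotSpace X P) {n m : ℕ} {g : Euc n × Euc m → X}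
    (h : ∀ κ : Euc (n + m) → Euc n × Euc m, ContDiff ℝ ∞ κ → P (n + m) (g ∘ κ)) :
    Continuous g := by
  let e : Euc (n + m) ≃L[ℝ] Euc n × Euc m := ContinuousLinearEquiv.ofFinrankEq (by simp)
  have := (hX.continuous_plot (h e e.contDiff)).comp e.symm.continuous
  simpa [Function.comp_def] using this

end IsPlotSpace

theorem DeltaProd.continuous_mk {W : Type*} [TopologicalSpace W] [DeltaGeneratedSpace W] {f : W → X}
    {g : W → Y} (hf : Continuous f) (hg : Continuous g) :
    Continuous fun w ↦ (Topology.WithGeneratedByTopology.equiv.symm (f w, g w) : DeltaProd X Y) :=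
  (Topology.IsGeneratedBy.equiv_symm_comp_continuous_iff (X := fun n : ℕ ↦ (Fin n → ℝ))
    (fun w ↦ (f w, g w))).2 (hf.prodMk hg)

theorem DeltaProd.continuous_pair : Continuous fun z : DeltaProd X Y ↦ z.pair :=
  Topology.WithGeneratedByTopology.continuous_equiv

/-- Each point of `U` lies in a ball homeomorphic to `ℝⁿ`. This serves to pass Delta-generation to
open subspaces, such as the strata and the parts of the total space over trivializing sets. -/
instance deltaGeneratedSpace_opens (n : ℕ) (U : TopologicalSpace.Opens (Fin n → ℝ)) :
    DeltaGeneratedSpace U := by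
  refine ⟨continuous_def.2 fun A hA ↦ ?_⟩
  rw [isOpen_iff_mem_nhds]
  intro x hx
  let e : (Fin n → ℝ) ≃ₜ Euc n := (EuclideanSpace.equiv (Fin n) ℝ).symm.toHomeomorph
  obtain ⟨ε, hε, hεU⟩ := Metric.mem_nhds_iff.1 ((U.isOpen.preimage e.symm.continuous).mem_nhds
    (x := e x) (by simp))
  set κ := OpenPartialHomeomorph.univBall (e x) ε with hκ
  have hκ0 : κ 0 = e x := OpenPartialHomeomorph.univBall_apply_zero _ ε
  have hsrc : κ.source = univ := OpenPartialHomeomorph.univBall_source _ ε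
  have hmap : ∀ v, e.symm (κ v) ∈ U := fun v ↦ by
    refine hεU ?_
    rw [← OpenPartialHomeomorph.univBall_target (e x) hε]
    exact κ.map_source (by rw [hsrc]; trivial)
  let c : C(Fin n → ℝ, U) := ⟨fun v ↦ ⟨e.symm (κ (e v)), hmap (e v)⟩, by
    refine Continuous.subtype_mk (e.symm.continuous.comp
      ((OpenPartialHomeomorph.continuous_univBall _ ε).comp e.continuous)) _⟩
  have h1 := Topology.WithGeneratedByTopology.isOpen_iff.1 hA c
  have hx0 : c (e.symm 0) = x := Subtype.ext (by simp [c, hκ0])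
  have h2 : ∀ᶠ v in 𝓝 (e.symm 0), c v ∈
      (Topology.WithGeneratedByTopology.equiv (X := fun n : ℕ ↦ (Fin n → ℝ))).symm ⁻¹' A :=
    h1.mem_nhds (by simpa only [mem_preimage, hx0] using hx)
  have h3 : map (fun v ↦ e.symm (κ (e v))) (𝓝 (e.symm 0)) = 𝓝 (x : Fin n → ℝ) := by
    rw [show (fun v ↦ e.symm (κ (e v))) = e.symm ∘ κ ∘ e from rfl, ← map_map, ← map_map,
      e.map_nhds_eq, e.apply_symm_apply, κ.map_nhds_eq (by rw [hsrc]; trivial), hκ0,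
      e.symm.map_nhds_eq, e.symm_apply_apply]
  have h4 : map c (𝓝 (e.symm 0)) = 𝓝 x := by
    have h5 : map ((↑) : U → Fin n → ℝ) (map c (𝓝 (e.symm 0))) = map (↑) (𝓝 x) := by
      rw [map_map]
      exact h3.trans (map_nhds_subtype_coe_eq_nhds x.2 (U.isOpen.mem_nhds x.2)).symm
    exact map_injective Subtype.val_injective h5
  rw [← h4]
  exact h2

end PlotSpaces

/-! ### Stabilization, images of embeddings, compactness -/

section Stabilization

theorem stab_apply (p : ℕ) (x : Euc p) (i : ℕ) :
    stab p x i = if h : i < p then x ⟨i, h⟩ else 0 := by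
  split_ifs with h
  · exact Finsupp.embDomain_apply_self Fin.valEmbedding _ (⟨i, h⟩ : Fin p)
  · refine Finsupp.embDomain_of_notMem_range _ _ _ ?_
    rintro ⟨j, rfl⟩
    exact h j.2

/-- The first `q` coordinates of a point of `ℝ^∞`. -/
def trunc (q : ℕ) : (ℕ →₀ ℝ) →ₗ[ℝ] Euc q where
  toFun x := WithLp.toLp 2 fun i ↦ x i
  map_add' _ _ := rfl
  map_smul' _ _ := rfl

theorem trunc_apply (q : ℕ) (x : ℕ →₀ ℝ) (i : Fin q) : trunc q x i = x i := rfl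

/-- `stab` as a linear map. -/
def stabL (p : ℕ) : Euc p →ₗ[ℝ] (ℕ →₀ ℝ) where
  toFun := stab p
  map_add' x y := by
    ext i
    simp only [stab_apply, Finsupp.add_apply]
    split_ifs <;> simp
  map_smul' c x := by
    ext i
    simp only [stab_apply, Finsupp.smul_apply]
    split_ifs <;> simp

@[simp] theorem trunc_stab (p : ℕ) (x : Euc p) : trunc p (stab p x) = x := by
  ext i
  simp [trunc_apply, stab_apply]

theorem stab_injective (p : ℕ) : Function.Injective (stab p) :=
  Function.LeftInverse.injective (trunc_stab p)

/-- The coordinate map `ℝᵖ → ℝ^q`, an inclusion or a projection. -/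
def coordMap (p q : ℕ) : Euc p →L[ℝ] Euc q :=
  LinearMap.toContinuousLinearMap ((trunc q).comp (stabL p))

theorem coordMap_eq (p q : ℕ) (x : Euc p) : coordMap p q x = trunc q (stab p x) := rfl

theorem coordMap_apply (p q : ℕ) (x : Euc p) (i : Fin q) :
    coordMap p q x i = if h : (i : ℕ) < p then x ⟨i, h⟩ else 0 := by
  rw [coordMap_eq, trunc_apply, stab_apply]

theorem stab_coordMap {p q : ℕ} (h : p ≤ q) (x : Euc p) : stab q (coordMap p q x) = stab p x := by
  ext i
  rw [stab_apply, stab_apply]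
  split_ifs with h1 h2 h3
  · simp [coordMap_apply, h2]
  · simp [coordMap_apply, h2]
  · omega
  · rfl

theorem coordMap_injective {p q : ℕ} (h : p ≤ q) : Function.Injective (coordMap p q) :=
  fun x y hxy ↦ stab_injective p (by rw [← stab_coordMap h, ← stab_coordMap h, hxy])

theorem coordMap_mem_openCube {p q : ℕ} {x : Euc p} (hx : x ∈ openCube p) :
    coordMap p q x ∈ openCube q := by
  intro i
  rw [coordMap_apply]
  split_ifs with h
  · exact hx _
  · simp

variable {d : ℕ} {M : CompactManifold d}

/-- A smooth embedding stays one after composition with an injective linear map. -/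
theorem IsSmoothEmb.comp_linear {E F : Type*} [NormedAddCommGroup E] [NormedSpace ℝ E]
    [NormedAddCommGroup F] [NormedSpace ℝ F] {f : M → E} (hf : IsSmoothEmb (𝓡 d) f)
    {T : E →L[ℝ] F} (hT : Function.Injective T) : IsSmoothEmb (𝓡 d) (fun m ↦ T (f m)) where
  contMDiff := T.contDiff.contMDiff.comp hf.contMDiff
  isEmbedding := ((T.continuous.comp hf.contMDiff.continuous).isClosedEmbedding
    (hT.comp hf.isEmbedding.injective)).isEmbedding
  injective_mfderiv m := by
    have h1 := T.hasMFDerivAt.comp m (hf.contMDiff.mdifferentiableAt (x := m) (by simp)).hasMFDerivAt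
    rw [show (fun m ↦ T (f m)) = T ∘ f from rfl, h1.mfderiv]
    exact hT.comp (hf.injective_mfderiv m)

/-- Conversely, a smooth map is an embedding if some linear image of it is one. -/
theorem IsSmoothEmb.of_comp_linear {E F : Type*} [NormedAddCommGroup E] [NormedSpace ℝ E]
    [NormedAddCommGroup F] [NormedSpace ℝ F] {f : M → E} (hf : ContMDiff (𝓡 d) 𝓘(ℝ, E) ∞ f)
    {T : E →L[ℝ] F} (hT : IsSmoothEmb (𝓡 d) (fun m ↦ T (f m))) : IsSmoothEmb (𝓡 d) f where
  contMDiff := hf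
  isEmbedding := (hf.continuous.isClosedEmbedding fun x y h ↦
    hT.isEmbedding.injective (congrArg T h)).isEmbedding
  injective_mfderiv m := by
    have h1 := T.hasMFDerivAt.comp m (hf.mdifferentiableAt (x := m) (by simp)).hasMFDerivAt
    have h2 := hT.injective_mfderiv m
    rw [show (fun m ↦ T (f m)) = T ∘ f from rfl, h1.mfderiv] at h2
    exact Function.Injective.of_comp (f := T) h2

/-- The stabilization `Emb(M, Dᵖ) → Emb(M, D^q)`. -/
def Emb.stabilize {p q : ℕ} (h : p ≤ q) (φ : Emb M p) : Emb M q :=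
  ⟨fun m ↦ coordMap p q (φ.1 m), φ.2.1.comp_linear (coordMap_injective h),
    fun m ↦ coordMap_mem_openCube (φ.2.2 m)⟩

theorem EmbInf.incl_stabilize {p q : ℕ} (h : p ≤ q) (φ : Emb M p) :
    EmbInf.incl M q (φ.stabilize h) = EmbInf.incl M p φ :=
  Subtype.ext (funext fun m ↦ stab_coordMap h (φ.1 m))

/-- The image of an embedding. -/
def Emb.image {p : ℕ} (φ : Emb M p) : Psi d p :=
  ⟨range φ.1, (isCompact_range φ.2.1.contMDiff.continuous).isClosed, by
    rintro _ ⟨m, rfl⟩; exact φ.2.2 m, by simpa using φ.2.1.isSubmanifold_range⟩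

theorem PsiInf.incl_image {p : ℕ} (φ : Emb M p) :
    (PsiInf.incl d p φ.image).1 = range (EmbInf.incl M p φ).1 :=
  (range_comp (stab p) φ.1).symm

/-- The bundle projection, which sends an embedding to its image. -/
def EmbInf.proj (φ : EmbInf M) : PsiInfOf M :=
  ⟨⟨range φ.1, by
    obtain ⟨f, p, ψ, rfl⟩ := φ
    exact ⟨p, ψ.image, PsiInf.incl_image ψ⟩⟩, by
    obtain ⟨f, p, ψ, rfl⟩ := φ
    exact ⟨p, ψ.image, Subtype.ext (PsiInf.incl_image ψ), ψ.2.1.isDiffeomorphicTo_range⟩⟩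

theorem EmbInf.proj_coe (φ : EmbInf M) : (φ.proj).1.1 = range φ.1 := rfl

theorem exists_compact_openCube_subset (p : ℕ) : ∃ K : Set (Euc p), IsCompact K ∧ openCube p ⊆ K := by
  refine ⟨(EuclideanSpace.equiv (Fin p) ℝ).symm '' Metric.closedBall (0 : Fin p → ℝ) 1,
    (isCompact_closedBall (0 : Fin p → ℝ) 1).image
      (EuclideanSpace.equiv (Fin p) ℝ).symm.continuous, fun x hx ↦ ⟨fun i ↦ x i, ?_, rfl⟩⟩
  rw [mem_closedBall_zero_iff, pi_norm_le_iff_of_nonneg zero_le_one]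
  exact fun i ↦ (hx i).le

/-- The cube is bounded and `V` is closed in the whole of `ℝᵖ`; this is why only compact manifolds
occur. -/
theorem isCompact_of_psi {p : ℕ} (V : Psi d p) : IsCompact V.1 := by
  obtain ⟨K, hK, hsub⟩ := exists_compact_openCube_subset p
  exact hK.of_isClosed_subset V.2.1 (V.2.2.1.trans hsub)

/-- Every point of `ψ_d(Dᵖ)` is the image of an embedding of a compact manifold. -/
theorem exists_emb_image_eq {p : ℕ} (V : Psi d p) :
    ∃ (M : CompactManifold d) (φ : Emb M p), φ.image = V := by
  have h := V.2.2.2.isDiffeomorphicTo (isCompact_of_psi V)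
  obtain ⟨f, hf, hfV⟩ := h.exists_isSmoothEmb
  exact ⟨_, ⟨f, hf, fun m ↦ V.2.2.1 (hfV ▸ mem_range_self m)⟩, Subtype.ext hfV⟩

theorem EmbInf.exists_proj_eq (W : PsiInfOf M) : ∃ φ : EmbInf M, φ.proj = W := by
  obtain ⟨⟨_, hW⟩, p, V, hV, h⟩ := W
  obtain ⟨f, hf, hfV⟩ := h.exists_isSmoothEmb
  let φ : Emb M p := ⟨f, hf, fun m ↦ V.2.2.1 (hfV ▸ mem_range_self m)⟩
  have h1 : φ.image = V := Subtype.ext hfV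
  refine ⟨EmbInf.incl M p φ, Subtype.ext (Subtype.ext ?_)⟩
  rw [EmbInf.proj_coe, ← PsiInf.incl_image, h1]
  exact congrArg Subtype.val hV

/-- `M` embeds in some cube. -/
theorem exists_emb (M : CompactManifold d) : ∃ p, Nonempty (Emb M p) := by
  obtain ⟨p, f, hf⟩ := exists_isSmoothEmb M
  obtain ⟨C, hC⟩ := (isCompact_range hf.contMDiff.continuous).isBounded.exists_norm_le
  -- Dividing by `|C| + 1` puts the image strictly inside the cube; `C` itself may be zero, or
  -- negative if `M` is empty.
  have hC' : 0 < |C| + 1 := by positivity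
  let T : Euc p →L[ℝ] Euc p := (|C| + 1)⁻¹ • ContinuousLinearMap.id ℝ (Euc p)
  have hT : Function.Injective T := smul_right_injective (Euc p) (inv_ne_zero hC'.ne')
  refine ⟨p, ⟨fun m ↦ T (f m), hf.comp_linear hT, fun m i ↦ ?_⟩⟩
  have h1 : |f m i| ≤ C := (Real.norm_eq_abs _ ▸ PiLp.norm_apply_le (f m) i).trans (hC _ ⟨m, rfl⟩)
  change |(|C| + 1)⁻¹ * f m i| < 1
  rw [abs_mul, abs_inv, abs_of_pos hC', inv_mul_lt_iff₀ hC']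
  linarith [le_abs_self C]

end Stabilization

/-! ### Plots of the colimits; continuity of projection, group law and action -/

section PlotSpaces

variable {d : ℕ} {M : CompactManifold d}

/-- The plots of `ψ_d(D^∞)`. -/
def PsiInf.IsPlot (d n : ℕ) (f : Euc n → PsiInf d) : Prop :=
  ∃ (p : ℕ) (g : Euc n → Psi d p), Psi.IsPlot d p n g ∧ ∀ u, PsiInf.incl d p (g u) = f u

/-- The plots of `Emb(M, D^∞)`. -/
def EmbInf.IsPlot (M : CompactManifold d) (n : ℕ) (f : Euc n → EmbInf M) : Prop :=
  ∃ (p : ℕ) (g : Euc n → Emb M p), Emb.IsPlot M p n g ∧ ∀ u, EmbInf.incl M p (g u) = f u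

/-- The images of a plot of embeddings form a plot of submanifolds. -/
theorem Emb.IsPlot.image {p n : ℕ} {f : Euc n → Emb M p} (hf : Emb.IsPlot M p n f) :
    Psi.IsPlot d p n fun u ↦ (f u).image := by
  have hs := Emb.isPlot_iff.1 hf
  have hgraph : Psi.graph (fun u ↦ (f u).image) =
      range fun z : Euc n × M ↦ (z.1, (f z.1).1 z.2) := by
    refine Set.ext fun z ↦ ⟨?_, ?_⟩
    · rintro ⟨m, hm⟩
      exact ⟨(z.1, m), Prod.ext rfl hm⟩
    · rintro ⟨w, rfl⟩
      exact ⟨w.2, rfl⟩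
  obtain ⟨h1, h2⟩ := submersion_range_family hs fun u ↦ (f u).2.1
  constructor
  · rw [hgraph]; exact isClosed_range_family hs.continuous
  · rw [hgraph]; exact h1
  · rw [hgraph]; exact h2

/-- A colimit of plot topologies is the plot topology for the plots that factor through a finite
stage, so the colimit needs no separate treatment. -/
theorem isPlotSpace_embInf (M : CompactManifold d) : IsPlotSpace (EmbInf M) (EmbInf.IsPlot M) where
  eq := by
    refine TopologicalSpace.ext_iff.2 fun A ↦ ?_
    rw [isOpen_plotTopology_iff, isOpen_iSup_iff]
    simp only [isOpen_coinduced, isOpen_plotTopology_iff]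
    constructor
    · rintro h n f ⟨p, g, hg, hgf⟩
      obtain rfl : (fun u ↦ EmbInf.incl M p (g u)) = f := funext hgf
      exact h p n g hg
    · exact fun h p n g hg ↦ h n _ ⟨p, g, hg, fun _ ↦ rfl⟩
  const φ := by
    obtain ⟨f, p, ψ, rfl⟩ := φ
    exact ⟨p, fun _ ↦ ψ, Emb.isPlot_iff.2 (ψ.2.1.contMDiff.comp contMDiff_snd), fun _ ↦ rfl⟩

theorem isPlotSpace_psiInf (d : ℕ) : IsPlotSpace (PsiInf d) (PsiInf.IsPlot d) where
  eq := by
    refine TopologicalSpace.ext_iff.2 fun A ↦ ?_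
    rw [isOpen_plotTopology_iff, isOpen_iSup_iff]
    simp only [isOpen_coinduced, isOpen_plotTopology_iff]
    constructor
    · rintro h n f ⟨p, g, hg, hgf⟩
      obtain rfl : (fun u ↦ PsiInf.incl d p (g u)) = f := funext hgf
      exact h p n g hg
    · exact fun h p n g hg ↦ h n _ ⟨p, g, hg, fun _ ↦ rfl⟩
  const W := by
    obtain ⟨_, p, V, rfl⟩ := W
    -- The constant family at `V` is a plot because it is the image of a constant family of
    -- embeddings.
    obtain ⟨M, φ, rfl⟩ := exists_emb_image_eq V
    have h : Emb.IsPlot M p 0 fun _ ↦ φ := Emb.isPlot_iff.2 (φ.2.1.contMDiff.comp contMDiff_snd)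
    exact ⟨p, _, h.image, fun _ ↦ rfl⟩

theorem isPlotSpace_diff (M : CompactManifold d) : IsPlotSpace (Diff M) (Diff.IsPlot M) where
  eq := rfl
  const g := ⟨g.toDiffeo.contMDiff.comp contMDiff_snd, g.toDiffeo.symm.contMDiff.comp contMDiff_snd⟩

theorem continuous_coe_proj : Continuous fun φ : EmbInf M ↦ (φ.proj.1 : PsiInf d) := by
  rw [(isPlotSpace_embInf M).continuous_iff]
  rintro n f ⟨p, g, hg, hgf⟩
  refine (isPlotSpace_psiInf d).continuous_plot ⟨p, _, hg.image, fun u ↦ Subtype.ext ?_⟩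
  rw [PsiInf.incl_image, hgf]
  rfl

theorem continuous_proj : Continuous (EmbInf.proj : EmbInf M → PsiInfOf M) :=
  Continuous.subtype_mk continuous_coe_proj _

theorem isDeltaGroup_diff (M : CompactManifold d) : IsDeltaGroup (Diff M) where
  deltaGenerated := (isPlotSpace_diff M).deltaGeneratedSpace
  continuous_mul := by
    refine (isPlotSpace_diff M).continuous_deltaProd (isPlotSpace_diff M)
      (g := fun z ↦ z.1 * z.2) fun n m f k hf hk ↦ ?_
    refine (isPlotSpace_diff M).continuous_of_prod fun κ hκ ↦ ?_
    have h1 : ContDiff ℝ ∞ fun v ↦ (κ v).1 := hκ.fst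
    have h2 : ContDiff ℝ ∞ fun v ↦ (κ v).2 := hκ.snd
    constructor
    · exact hf.1.comp ((h1.contMDiff.comp contMDiff_fst).prodMk
        (hk.1.comp ((h2.contMDiff.comp contMDiff_fst).prodMk contMDiff_snd)))
    · exact hk.2.comp ((h2.contMDiff.comp contMDiff_fst).prodMk
        (hf.2.comp ((h1.contMDiff.comp contMDiff_fst).prodMk contMDiff_snd)))
  continuous_inv := by
    rw [(isPlotSpace_diff M).continuous_iff]
    exact fun n f hf ↦ (isPlotSpace_diff M).continuous_plot ⟨hf.2, hf.1⟩

theorem continuous_act :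
    Continuous fun z : DeltaProd (EmbInf M) (Diff M) ↦ EmbInf.act z.pair.1 z.pair.2 := by
  refine (isPlotSpace_embInf M).continuous_deltaProd (isPlotSpace_diff M)
    (g := fun z ↦ EmbInf.act z.1 z.2) fun n m f k hf hk ↦ ?_
  refine (isPlotSpace_embInf M).continuous_of_prod fun κ hκ ↦ ?_
  obtain ⟨p, g, hg, hgf⟩ := hf
  have h1 : ContDiff ℝ ∞ fun v ↦ (κ v).1 := hκ.fst
  have h2 : ContDiff ℝ ∞ fun v ↦ (κ v).2 := hκ.snd
  refine ⟨p, fun v ↦ ⟨fun x ↦ (g (κ v).1).1 ((k (κ v).2).toDiffeo x),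
    (g (κ v).1).2.1.comp_diffeo _, fun x ↦ (g (κ v).1).2.2 _⟩, ?_, fun v ↦ ?_⟩
  · exact Emb.isPlot_iff.2 ((Emb.isPlot_iff.1 hg).comp ((h1.contMDiff.comp contMDiff_fst).prodMk
        (hk.1.comp ((h2.contMDiff.comp contMDiff_fst).prodMk contMDiff_snd))))
  · refine Subtype.ext (funext fun x ↦ ?_)
    change stab p ((g (κ v).1).1 _) = (f (κ v).1).1 _
    rw [← hgf]
    rfl

end PlotSpaces

/-! ### Contractibility of the space of embeddings -/

section Contractible

variable {d : ℕ} {M : CompactManifold d}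

theorem stab_trunc {q : ℕ} {x : ℕ →₀ ℝ} (h : ∀ i, q ≤ i → x i = 0) : stab q (trunc q x) = x := by
  ext i
  rw [stab_apply]
  split_ifs with hi
  · rfl
  · exact (h i (not_lt.1 hi)).symm

theorem stab_eq_zero {p i : ℕ} (hi : p ≤ i) (x : Euc p) : stab p x i = 0 := by
  rw [stab_apply, dif_neg (not_lt.2 hi)]

theorem abs_stab_lt_one {p : ℕ} {x : Euc p} (hx : x ∈ openCube p) (i : ℕ) : |stab p x i| < 1 := by
  rw [stab_apply]
  split_ifs with h
  · exact hx _
  · simp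

theorem EmbInf.abs_lt_one (φ : EmbInf M) (m : M) (i : ℕ) : |φ.1 m i| < 1 := by
  obtain ⟨_, p, ψ, rfl⟩ := φ
  exact abs_stab_lt_one (ψ.2.2 m) i

/-- A criterion for a map to `ℝ^∞` to be an embedding. -/
theorem exists_emb_of_trunc {f : M → ℕ →₀ ℝ} {q : ℕ} (h0 : ∀ m i, q ≤ i → f m i = 0)
    (hf : IsSmoothEmb (𝓡 d) fun m ↦ trunc q (f m)) (h1 : ∀ m i, |f m i| < 1) :
    ∃ (p : ℕ) (φ : Emb M p), (fun m ↦ stab p (φ.1 m)) = f :=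
  ⟨q, ⟨_, hf, fun m i ↦ h1 m i⟩, funext fun m ↦ stab_trunc (h0 m)⟩

/-- A criterion for a family of embeddings in `ℝ^∞` to be a plot. -/
theorem EmbInf.isPlot_of_trunc {n q : ℕ} {f : Euc n → EmbInf M}
    (h0 : ∀ u m i, q ≤ i → (f u).1 m i = 0)
    (hf : ContMDiff ((𝓡 n).prod (𝓡 d)) (𝓡 q) ∞ fun z : Euc n × M ↦ trunc q ((f z.1).1 z.2)) :
    EmbInf.IsPlot M n f := by
  -- The stage `p` at which `f u` is known to be an embedding depends on `u` and is unrelated to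
  -- `q`; the property is carried over to `q` through `coordMap q p`.
  have hemb : ∀ u, IsSmoothEmb (𝓡 d) fun m ↦ trunc q ((f u).1 m) := by
    intro u
    obtain ⟨p, ψ, hψ⟩ := (f u).2
    refine .of_comp_linear (T := coordMap q p) (hf.comp (contMDiff_const.prodMk contMDiff_id)) ?_
    have : (fun m ↦ coordMap q p (trunc q ((f u).1 m))) = ψ.1 := funext fun m ↦ by
      rw [coordMap_eq, stab_trunc (h0 u m), ← hψ, trunc_stab]
    rw [this]
    exact ψ.2.1
  refine ⟨q, fun u ↦ ⟨_, hemb u, fun m i ↦ (f u).abs_lt_one m i⟩, Emb.isPlot_iff.2 hf, fun u ↦ ?_⟩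
  exact Subtype.ext (funext fun m ↦ stab_trunc (h0 u m))

/-- The linear map of `ℝ^∞` which moves the `i`-th coordinate to the place `2 i + 1`. -/
def oddShift : (ℕ →₀ ℝ) →ₗ[ℝ] (ℕ →₀ ℝ) := Finsupp.lmapDomain ℝ ℝ fun i ↦ 2 * i + 1

/-- The linear map of `ℝ^∞` which moves the `i`-th coordinate to the place `2 i`. -/
def evenShift : (ℕ →₀ ℝ) →ₗ[ℝ] (ℕ →₀ ℝ) := Finsupp.lmapDomain ℝ ℝ fun i ↦ 2 * i

theorem oddShift_odd (x : ℕ →₀ ℝ) (i : ℕ) : oddShift x (2 * i + 1) = x i :=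
  Finsupp.mapDomain_apply (f := fun i ↦ 2 * i + 1) (fun a b h ↦ by simpa using h) x i

theorem oddShift_even (x : ℕ →₀ ℝ) (i : ℕ) : oddShift x (2 * i) = 0 := by
  refine Finsupp.mapDomain_of_notMem_range (f := fun i ↦ 2 * i + 1) x _ ?_
  rintro ⟨j, hj⟩
  have : 2 * j + 1 = 2 * i := hj
  omega

theorem evenShift_even (x : ℕ →₀ ℝ) (i : ℕ) : evenShift x (2 * i) = x i :=
  Finsupp.mapDomain_apply (f := fun i ↦ 2 * i) (fun a b h ↦ by simpa using h) x i

theorem evenShift_odd (x : ℕ →₀ ℝ) (i : ℕ) : evenShift x (2 * i + 1) = 0 := by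
  refine Finsupp.mapDomain_of_notMem_range (f := fun i ↦ 2 * i) x _ ?_
  rintro ⟨j, hj⟩
  have : 2 * j = 2 * i + 1 := hj
  omega

theorem oddShift_eq_zero {p i : ℕ} {x : ℕ →₀ ℝ} (hx : ∀ j, p ≤ j → x j = 0) (hi : 2 * p ≤ i) :
    oddShift x i = 0 := by
  obtain ⟨j, rfl | rfl⟩ := Nat.even_or_odd' i
  · exact oddShift_even x j
  · rw [oddShift_odd]; exact hx j (by omega)

theorem evenShift_eq_zero {p i : ℕ} {x : ℕ →₀ ℝ} (hx : ∀ j, p ≤ j → x j = 0) (hi : 2 * p ≤ i) :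
    evenShift x i = 0 := by
  obtain ⟨j, rfl | rfl⟩ := Nat.even_or_odd' i
  · rw [evenShift_even]; exact hx j (by omega)
  · exact evenShift_odd x j

theorem abs_oddShift_lt_one {x : ℕ →₀ ℝ} (hx : ∀ i, |x i| < 1) (i : ℕ) : |oddShift x i| < 1 := by
  obtain ⟨j, rfl | rfl⟩ := Nat.even_or_odd' i
  · simp [oddShift_even]
  · rw [oddShift_odd]; exact hx j

theorem abs_evenShift_lt_one {x : ℕ →₀ ℝ} (hx : ∀ i, |x i| < 1) (i : ℕ) : |evenShift x i| < 1 := by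
  obtain ⟨j, rfl | rfl⟩ := Nat.even_or_odd' i
  · rw [evenShift_even]; exact hx j
  · simp [evenShift_odd]

theorem abs_interpolate_lt_one {a b c : ℝ} (ha : |a| < 1) (hb : |b| < 1) (h0 : 0 ≤ c) (h1 : c ≤ 1) :
    |(1 - c) * a + c * b| < 1 := by
  rw [abs_lt] at *
  exact convex_Ioo (-1 : ℝ) 1 ha hb (sub_nonneg.2 h1) h0 (sub_add_cancel 1 c)

/-- For `c = 1` only the injective shift remains. Otherwise the system is triangular: the `i`-th
coordinate of the shift is zero or some `x j` with `j < i`, so the coordinates of `x` vanish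
inductively. -/
theorem interpolate_oddShift_injective {c : ℝ} {x : ℕ →₀ ℝ}
    (h : (1 - c) • x + c • oddShift x = 0) : x = 0 := by
  have hi : ∀ i, (1 - c) * x i + c * oddShift x i = 0 := fun i ↦ DFunLike.congr_fun h i
  ext i
  induction i using Nat.strong_induction_on with
  | _ i ih =>
    by_cases hc : c = 1
    · have := hi (2 * i + 1)
      rw [oddShift_odd, hc] at this
      simpa using this
    · have h2 : oddShift x i = 0 := by
        obtain ⟨j, rfl | rfl⟩ := Nat.even_or_odd' i
        · exact oddShift_even x j
        · rw [oddShift_odd]; exact ih j (by omega)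
      have := hi i
      rw [h2, mul_zero, add_zero] at this
      exact (mul_eq_zero.1 this).resolve_left (sub_ne_zero.2 (Ne.symm hc))

/-- The homotopies run over all of `ℝ`, so that they can be tested along plots. This coefficient is
smooth and stays in `[0, 1]`, which keeps the interpolated embeddings inside the cube. -/
theorem smoothTransition_mem (t : ℝ) :
    0 ≤ Real.smoothTransition t ∧ Real.smoothTransition t ≤ 1 :=
  ⟨Real.smoothTransition.nonneg t, Real.smoothTransition.le_one t⟩

/-- The straight-line homotopy from the identity to the odd shift. -/
def EmbInf.toOdd (t : ℝ) (φ : EmbInf M) : EmbInf M :=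
  ⟨fun m ↦ (1 - Real.smoothTransition t) • φ.1 m + Real.smoothTransition t • oddShift (φ.1 m), by
    obtain ⟨_, p, ψ, rfl⟩ := φ
    obtain ⟨hc0, hc1⟩ := smoothTransition_mem t
    generalize Real.smoothTransition t = c at *
    have hzero : ∀ (x : Euc p) (i : ℕ), 2 * p ≤ i →
        ((1 - c) • stab p x + c • oddShift (stab p x)) i = 0 := by
      intro x i hi
      rw [Finsupp.add_apply, Finsupp.smul_apply, Finsupp.smul_apply,
        oddShift_eq_zero (fun j hj ↦ stab_eq_zero hj x) hi, stab_eq_zero (by omega)]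
      simp
    refine exists_emb_of_trunc (q := 2 * p) (fun m i hi ↦ hzero _ i hi) ?_ fun m i ↦ ?_
    · let T : Euc p →L[ℝ] Euc (2 * p) := LinearMap.toContinuousLinearMap
        ((trunc (2 * p)).comp (((1 - c) • LinearMap.id + c • oddShift).comp (stabL p)))
      have hT : ∀ x, T x = trunc (2 * p) ((1 - c) • stab p x + c • oddShift (stab p x)) :=
        fun x ↦ rfl
      refine ψ.2.1.comp_linear (T := T) ((injective_iff_map_eq_zero T).2 fun x hx ↦ ?_)
      rw [hT] at hx
      have h1 := congrArg (stab (2 * p)) hx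
      rw [stab_trunc (hzero x), show stab (2 * p) 0 = 0 from (stabL (2 * p)).map_zero] at h1
      have h2 := interpolate_oddShift_injective h1
      rw [← trunc_stab p x, h2, map_zero]
    · exact abs_interpolate_lt_one (abs_stab_lt_one (ψ.2.2 m) i)
        (abs_oddShift_lt_one (abs_stab_lt_one (ψ.2.2 m)) i) hc0 hc1⟩

/-- The straight-line homotopy from the odd shift to a constant map. -/
def EmbInf.oddToConst (φ₀ : EmbInf M) (t : ℝ) (φ : EmbInf M) : EmbInf M :=
  ⟨fun m ↦ (1 - Real.smoothTransition t) • oddShift (φ.1 m) +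
      Real.smoothTransition t • evenShift (φ₀.1 m), by
    obtain ⟨_, p, ψ, rfl⟩ := φ
    obtain ⟨_, p₀, ψ₀, rfl⟩ := φ₀
    obtain ⟨hc0, hc1⟩ := smoothTransition_mem t
    generalize Real.smoothTransition t = c at *
    have hzero : ∀ m (i : ℕ), 2 * p + 2 * p₀ ≤ i →
        ((1 - c) • oddShift (stab p (ψ.1 m)) + c • evenShift (stab p₀ (ψ₀.1 m))) i = 0 := by
      intro m i hi
      rw [Finsupp.add_apply, Finsupp.smul_apply, Finsupp.smul_apply,
        oddShift_eq_zero (fun j hj ↦ stab_eq_zero hj _) (by omega : 2 * p ≤ i),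
        evenShift_eq_zero (fun j hj ↦ stab_eq_zero hj _) (by omega : 2 * p₀ ≤ i)]
      simp
    refine exists_emb_of_trunc hzero ?_ fun m i ↦ ?_
    · set q := 2 * p + 2 * p₀
      let A : Euc p →L[ℝ] Euc q := LinearMap.toContinuousLinearMap
        ((trunc q).comp (((1 - c) • oddShift).comp (stabL p)))
      let B : Euc p₀ →L[ℝ] Euc q := LinearMap.toContinuousLinearMap
        ((trunc q).comp ((c • evenShift).comp (stabL p₀)))
      have hsm : ContMDiff (𝓡 d) (𝓡 q) ∞ fun m ↦ trunc q
          ((1 - c) • oddShift (stab p (ψ.1 m)) + c • evenShift (stab p₀ (ψ₀.1 m))) :=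
        (A.contDiff.contMDiff.comp ψ.2.1.contMDiff).add (B.contDiff.contMDiff.comp ψ₀.2.1.contMDiff)
      -- For `c ≠ 0` the even coordinates alone already embed, being a multiple of `ψ₀`; for `c = 0`
      -- the odd ones recover `ψ`.
      by_cases hc : c = 0
      · let T : Euc q →L[ℝ] Euc p := LinearMap.toContinuousLinearMap
          ((trunc p).comp ((Finsupp.lcomapDomain (fun i ↦ 2 * i + 1)
            (fun a b h ↦ by simpa using h)).comp (stabL q)))
        refine .of_comp_linear (T := T) hsm ?_
        convert ψ.2.1 using 2 with m
        ext i
        change stab q (trunc q ((1 - c) • oddShift (stab p (ψ.1 m)) +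
          c • evenShift (stab p₀ (ψ₀.1 m)))) (2 * i + 1) = ψ.1 m i
        rw [stab_trunc (hzero m), hc, zero_smul, sub_zero, one_smul, add_zero, oddShift_odd,
          stab_apply, dif_pos i.2]
      · let T : Euc q →L[ℝ] Euc p₀ := LinearMap.toContinuousLinearMap
          ((trunc p₀).comp ((c⁻¹ • Finsupp.lcomapDomain (fun i ↦ 2 * i)
            (fun a b h ↦ by simpa using h)).comp (stabL q)))
        refine .of_comp_linear (T := T) hsm ?_
        convert ψ₀.2.1 using 2 with m
        ext i
        change c⁻¹ * stab q (trunc q ((1 - c) • oddShift (stab p (ψ.1 m)) +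
          c • evenShift (stab p₀ (ψ₀.1 m)))) (2 * i) = ψ₀.1 m i
        rw [stab_trunc (hzero m), Finsupp.add_apply, Finsupp.smul_apply, Finsupp.smul_apply,
          oddShift_even, evenShift_even, stab_apply, dif_pos i.2]
        simp [hc]
    · exact abs_interpolate_lt_one (abs_oddShift_lt_one (abs_stab_lt_one (ψ.2.2 m)) i)
        (abs_evenShift_lt_one (abs_stab_lt_one (ψ₀.2.2 m)) i) hc0 hc1⟩

/-- A family of maps is jointly continuous if it is smooth along plots. -/
theorem EmbInf.continuous_homotopy {H : ℝ → EmbInf M → EmbInf M}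
    (h : ∀ (n k : ℕ) (f : Euc n → EmbInf M), EmbInf.IsPlot M n f → ∀ (κ : Euc k → Euc n)
      (τ : Euc k → ℝ), ContDiff ℝ ∞ κ → ContDiff ℝ ∞ τ →
      EmbInf.IsPlot M k fun v ↦ H (τ v) (f (κ v))) :
    Continuous fun p : EmbInf M × ℝ ↦ H p.2 p.1 := by
  refine (isPlotSpace_embInf M).continuous_prod fun n f hf ↦ ?_
  have h1 : Continuous fun p : Euc n × Euc 1 ↦ H (p.2 0) (f p.1) := by
    refine (isPlotSpace_embInf M).continuous_of_prod fun κ hκ ↦ ?_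
    exact h n (n + 1) f hf (fun v ↦ (κ v).1) (fun v ↦ (κ v).2 0) hκ.fst
      ((EuclideanSpace.proj (0 : Fin 1) : Euc 1 →L[ℝ] ℝ).contDiff.comp hκ.snd)
  have h2 : Continuous fun t : ℝ ↦ ((EuclideanSpace.equiv (Fin 1) ℝ).symm fun _ ↦ t : Euc 1) :=
    (EuclideanSpace.equiv (Fin 1) ℝ).symm.continuous.comp (continuous_pi fun _ ↦ continuous_id)
  exact h1.comp (continuous_fst.prodMk (h2.comp continuous_snd))

theorem EmbInf.isPlot_interpolate {n p q : ℕ} {f : Euc n → EmbInf M} {τ : Euc n → ℝ}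
    {a b : Euc n × M → ℕ →₀ ℝ} (hf : ∀ u m, (f u).1 m =
      (1 - Real.smoothTransition (τ u)) • a (u, m) + Real.smoothTransition (τ u) • b (u, m))
    (hτ : ContDiff ℝ ∞ τ) (ha0 : ∀ z i, p ≤ i → a z i = 0) (hb0 : ∀ z i, q ≤ i → b z i = 0)
    (ha : ∀ r, ContMDiff ((𝓡 n).prod (𝓡 d)) (𝓡 r) ∞ fun z ↦ trunc r (a z))
    (hb : ∀ r, ContMDiff ((𝓡 n).prod (𝓡 d)) (𝓡 r) ∞ fun z ↦ trunc r (b z)) :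
    EmbInf.IsPlot M n f := by
  refine EmbInf.isPlot_of_trunc (q := p + q) (fun u m i hi ↦ ?_) ?_
  · rw [hf, Finsupp.add_apply, Finsupp.smul_apply, Finsupp.smul_apply, ha0 _ _ (by omega),
      hb0 _ _ (by omega)]
    simp
  · have hρ : ContMDiff ((𝓡 n).prod (𝓡 d)) 𝓘(ℝ, ℝ) ∞
        fun z : Euc n × M ↦ Real.smoothTransition (τ z.1) :=
      (Real.smoothTransition.contDiff.comp hτ).contMDiff.comp contMDiff_fst
    have : (fun z : Euc n × M ↦ trunc (p + q) ((f z.1).1 z.2)) = fun z ↦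
        (1 - Real.smoothTransition (τ z.1)) • trunc (p + q) (a z) +
        Real.smoothTransition (τ z.1) • trunc (p + q) (b z) := by
      funext z
      rw [hf, map_add, map_smul, map_smul]
    rw [this]
    exact ((contMDiff_const.sub hρ).smul (ha _)).add (hρ.smul (hb _))

theorem contMDiff_trunc_linear {n p : ℕ} {g : Euc n → Emb M p} (hg : Emb.IsPlot M p n g)
    {k r : ℕ} {κ : Euc k → Euc n} (hκ : ContDiff ℝ ∞ κ) (A : (ℕ →₀ ℝ) →ₗ[ℝ] (ℕ →₀ ℝ)) :
    ContMDiff ((𝓡 k).prod (𝓡 d)) (𝓡 r) ∞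
      fun z : Euc k × M ↦ trunc r (A (stab p ((g (κ z.1)).1 z.2))) := by
  let T : Euc p →L[ℝ] Euc r := LinearMap.toContinuousLinearMap ((trunc r).comp (A.comp (stabL p)))
  exact T.contDiff.contMDiff.comp ((Emb.isPlot_iff.1 hg).comp
    ((hκ.contMDiff.comp contMDiff_fst).prodMk contMDiff_snd))

theorem EmbInf.continuous_toOdd : Continuous fun p : EmbInf M × ℝ ↦ EmbInf.toOdd p.2 p.1 := by
  refine EmbInf.continuous_homotopy fun n k f hf κ τ hκ hτ ↦ ?_
  obtain ⟨p, g, hg, hgf⟩ := hf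
  refine EmbInf.isPlot_interpolate (p := p) (q := 2 * p) (τ := τ)
    (a := fun z ↦ stab p ((g (κ z.1)).1 z.2)) (b := fun z ↦ oddShift (stab p ((g (κ z.1)).1 z.2)))
    (fun u m ↦ ?_) hτ (fun z i hi ↦ stab_eq_zero hi _)
    (fun z i hi ↦ oddShift_eq_zero (fun j hj ↦ stab_eq_zero hj _) hi)
    (fun r ↦ contMDiff_trunc_linear hg hκ LinearMap.id)
    (fun r ↦ contMDiff_trunc_linear hg hκ oddShift)
  rw [← hgf]
  rfl

theorem EmbInf.continuous_oddToConst (φ₀ : EmbInf M) :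
    Continuous fun p : EmbInf M × ℝ ↦ EmbInf.oddToConst φ₀ p.2 p.1 := by
  refine EmbInf.continuous_homotopy fun n k f hf κ τ hκ hτ ↦ ?_
  obtain ⟨p, g, hg, hgf⟩ := hf
  obtain ⟨_, p₀, ψ₀, rfl⟩ := φ₀
  have hψ₀ : Emb.IsPlot M p₀ 0 fun _ ↦ ψ₀ :=
    Emb.isPlot_iff.2 (ψ₀.2.1.contMDiff.comp contMDiff_snd)
  refine EmbInf.isPlot_interpolate (p := 2 * p) (q := 2 * p₀) (τ := τ)
    (a := fun z ↦ oddShift (stab p ((g (κ z.1)).1 z.2)))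
    (b := fun z ↦ evenShift (stab p₀ (ψ₀.1 z.2)))
    (fun u m ↦ ?_) hτ (fun z i hi ↦ oddShift_eq_zero (fun j hj ↦ stab_eq_zero hj _) hi)
    (fun z i hi ↦ evenShift_eq_zero (fun j hj ↦ stab_eq_zero hj _) hi)
    (fun r ↦ contMDiff_trunc_linear hg hκ oddShift)
    (fun r ↦ contMDiff_trunc_linear hψ₀ (κ := fun _ ↦ 0) contDiff_const evenShift)
  rw [← hgf]
  rfl

theorem EmbInf.toOdd_zero (φ : EmbInf M) : EmbInf.toOdd 0 φ = φ :=
  Subtype.ext (funext fun m ↦ by simp [EmbInf.toOdd])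

theorem EmbInf.oddToConst_zero (φ₀ φ : EmbInf M) : EmbInf.oddToConst φ₀ 0 φ = EmbInf.toOdd 1 φ :=
  Subtype.ext (funext fun m ↦ by simp [EmbInf.toOdd, EmbInf.oddToConst])

theorem EmbInf.oddToConst_one (φ₀ φ : EmbInf M) :
    EmbInf.oddToConst φ₀ 1 φ = EmbInf.oddToConst φ₀ 1 φ₀ :=
  Subtype.ext (funext fun m ↦ by simp [EmbInf.oddToConst])

theorem homotopic_of_continuous {X Y : Type*} [TopologicalSpace X] [TopologicalSpace Y]
    {H : ℝ → X → Y} (hH : Continuous fun p : X × ℝ ↦ H p.2 p.1) {f g : C(X, Y)}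
    (h0 : ∀ x, H 0 x = f x) (h1 : ∀ x, H 1 x = g x) : f.Homotopic g :=
  ⟨{ toFun := fun z ↦ H z.1 z.2
     continuous_toFun := hH.comp (continuous_snd.prodMk (continuous_subtype_val.comp continuous_fst))
     map_zero_left := h0
     map_one_left := h1 }⟩

theorem EmbInf.continuous_toOdd_one : Continuous (EmbInf.toOdd (M := M) 1) :=
  EmbInf.continuous_toOdd.comp (f := fun φ ↦ (φ, 1)) (continuous_id.prodMk continuous_const)

theorem contractibleSpace_embInf (M : CompactManifold d) : ContractibleSpace (EmbInf M) := by
  obtain ⟨p₀, ⟨ψ₀⟩⟩ := exists_emb M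
  have φ₀ : EmbInf M := EmbInf.incl M p₀ ψ₀
  have h1 : (ContinuousMap.id (EmbInf M)).Homotopic ⟨_, EmbInf.continuous_toOdd_one⟩ :=
    homotopic_of_continuous EmbInf.continuous_toOdd EmbInf.toOdd_zero fun _ ↦ rfl
  have h2 : (⟨_, EmbInf.continuous_toOdd_one⟩ : C(EmbInf M, EmbInf M)).Homotopic
      (ContinuousMap.const _ (EmbInf.oddToConst φ₀ 1 φ₀)) :=
    homotopic_of_continuous (EmbInf.continuous_oddToConst φ₀) (EmbInf.oddToConst_zero φ₀)
      (EmbInf.oddToConst_one φ₀)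
  exact (contractible_iff_id_nullhomotopic _).2 ⟨_, h1.trans h2⟩

end Contractible

/-! ### Local trivializations and the decomposition into strata -/

section Bundle

variable {d : ℕ} {M : CompactManifold d}

theorem EmbInf.injective (φ : EmbInf M) : Function.Injective φ.1 := by
  obtain ⟨_, p, ψ, rfl⟩ := φ
  exact (stab_injective p).comp ψ.2.1.isEmbedding.injective



/-- Embeddings in `ℝ^∞` with the same image differ by a diffeomorphism. -/
theorem EmbInf.exists_diffeomorph {M' : CompactManifold d} (φ : EmbInf M) (φ' : EmbInf M')
    (h : range φ.1 = range φ'.1) : ∃ k : M ≃ₘ^∞⟮𝓡 d, 𝓡 d⟯ M', ∀ x, φ'.1 (k x) = φ.1 x := by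
  obtain ⟨_, p, ψ, rfl⟩ := φ
  obtain ⟨_, p', ψ', rfl⟩ := φ'
  have h1 := congrArg Subtype.val (EmbInf.incl_stabilize (le_max_left p p') ψ)
  have h2 := congrArg Subtype.val (EmbInf.incl_stabilize (le_max_right p p') ψ')
  have h3 : range (ψ.stabilize (le_max_left p p')).1 = range (ψ'.stabilize (le_max_right p p')).1 := by
    refine (stab_injective (max p p')).image_injective ?_
    rw [← range_comp, ← range_comp]
    exact (congrArg range h1).trans (h.trans (congrArg range h2).symm)
  obtain ⟨k, hk⟩ := IsSmoothEmb.exists_diffeomorph (ψ.stabilize (le_max_left p p')).2.1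
    (ψ'.stabilize (le_max_right p p')).2.1 h3
  refine ⟨k, fun x ↦ ?_⟩
  refine (congrFun h2 (k x)).symm.trans (Eq.trans ?_ (congrFun h1 x))
  exact congrArg (stab (max p p')) (hk x)

theorem EmbInf.exists_act_eq {φ φ' : EmbInf M} (h : φ.proj = φ'.proj) :
    ∃ g : Diff M, φ = EmbInf.act φ' g := by
  obtain ⟨k, hk⟩ := φ.exists_diffeomorph φ'
    (congrArg (fun W : PsiInfOf M ↦ W.1.1) h)
  exact ⟨k, Subtype.ext (funext fun x ↦ (hk x).symm)⟩

theorem EmbInf.act_injective (φ : EmbInf M) : Function.Injective (EmbInf.act φ) := by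
  intro g h hgh
  refine Diffeomorph.ext fun m ↦ φ.injective ?_
  exact congrFun (congrArg Subtype.val hgh) m

theorem EmbInf.act_one (φ : EmbInf M) : EmbInf.act φ 1 = φ := rfl

theorem EmbInf.act_mul (φ : EmbInf M) (g h : Diff M) :
    EmbInf.act φ (g * h) = EmbInf.act (EmbInf.act φ g) h := rfl

theorem EmbInf.proj_act (φ : EmbInf M) (g : Diff M) : (EmbInf.act φ g).proj = φ.proj := by
  refine Subtype.ext (Subtype.ext ?_)
  exact g.toDiffeo.surjective.range_comp φ.1

/-- The embeddings which are sections of the partially defined map `r ∘ trunc p` to `M`. -/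
def IsNormalized (p : ℕ) (O : Set (Euc p)) (r : Euc p → M) (φ : EmbInf M) : Prop :=
  ∀ m, trunc p (φ.1 m) ∈ O ∧ r (trunc p (φ.1 m)) = m

/-- The map `r ∘ trunc p` is a left inverse of both parametrizations, so it reads off the parameter
of each point of the common image. -/
theorem IsNormalized.unique {p : ℕ} {O : Set (Euc p)} {r : Euc p → M} {φ φ' : EmbInf M}
    (h : IsNormalized p O r φ) (h' : IsNormalized p O r φ') (hproj : φ.proj.1 = φ'.proj.1) :
    φ = φ' := by
  refine Subtype.ext (funext fun m ↦ ?_)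
  have hrange : range φ.1 = range φ'.1 := congrArg Subtype.val hproj
  obtain ⟨m', hm'⟩ : φ.1 m ∈ range φ'.1 := hrange ▸ mem_range_self m
  have h1 := (h m).2
  rw [← hm', (h' m').2] at h1
  rw [← hm', h1]

/-- Near a submanifold with a normalized parametrization, a plot of submanifolds has a smooth family
of normalized parametrizations. -/
theorem exists_normalized_family {p : ℕ} {O : Set (Euc p)} (hO : IsOpen O) {r : Euc p → M}
    (hr : ContMDiffOn (𝓡 p) (𝓡 d) ∞ r O) {n : ℕ} {f : Euc n → PsiInf d} (hf : PsiInf.IsPlot d n f)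
    {u₀ : Euc n} {φ : EmbInf M} (hφ : φ.proj.1 = f u₀) (hφr : IsNormalized p O r φ) :
    ∃ U : Set (Euc n), IsOpen U ∧ u₀ ∈ U ∧ ∃ (q : ℕ) (s : Euc n × M → Euc q),
      ContMDiffOn ((𝓡 n).prod (𝓡 d)) (𝓡 q) ∞ s (U ×ˢ univ) ∧
      ∀ u ∈ U, ∃ ψ : Emb M q, (∀ m, ψ.1 m = s (u, m)) ∧ (EmbInf.incl M q ψ).proj.1 = f u ∧
        IsNormalized p O r (EmbInf.incl M q ψ) := by
  obtain ⟨q, g, hg, hgf⟩ := hf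
  obtain ⟨K, hK, hcube⟩ := exists_compact_openCube_subset q
  have hrange : range φ.1 = stab q '' (g u₀).1 := by
    have := congrArg Subtype.val (hφ.trans (hgf u₀).symm)
    exact this
  have hmem : ∀ m, ∃ x ∈ (g u₀).1, stab q x = φ.1 m := fun m ↦ by
    have : φ.1 m ∈ stab q '' (g u₀).1 := hrange ▸ mem_range_self m
    exact this
  have hstab : ∀ m, stab q (trunc q (φ.1 m)) = φ.1 m := fun m ↦ by
    obtain ⟨x, -, hx⟩ := hmem m
    rw [← hx, trunc_stab]
  have hsmooth : ContMDiff (𝓡 d) (𝓡 q) ∞ fun m ↦ trunc q (φ.1 m) := by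
    obtain ⟨_, p', ψ, rfl⟩ := φ
    exact (coordMap p' q).contDiff.contMDiff.comp ψ.2.1.contMDiff
  have hcoord : ∀ x, coordMap q p x = trunc p (stab q x) := coordMap_eq q p
  -- The plot lives in some `ℝ^q` unrelated to `p`. Pulling `O` and `r` back along `coordMap q p`,
  -- an inclusion or a projection, treats all `q` alike.
  obtain ⟨U, hU, hu₀, s, hs, hsU⟩ := exists_smooth_section (Γ := Psi.graph g)
    (N := (fun z : Euc n × Euc q ↦ coordMap q p z.2) ⁻¹' O) (ρ := fun z ↦ r (coordMap q p z.2))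
    (u₀ := u₀) (φ := fun m ↦ trunc q (φ.1 m)) hg.isClosed_graph hK
    (fun z hz ↦ hcube ((g z.1).2.2.1 hz)) hg.isSubmanifold_graph hg.submersion
    (hO.preimage ((coordMap q p).continuous.comp continuous_snd))
    (hr.comp ((coordMap q p).contDiff.comp contDiff_snd).contMDiff.contMDiffOn fun z hz ↦ hz)
    hsmooth
    (fun m ↦ by
      obtain ⟨x, hx, hxm⟩ := hmem m
      change trunc q (φ.1 m) ∈ (g u₀).1
      rwa [← hxm, trunc_stab])
    (fun m ↦ by
      change coordMap q p (trunc q (φ.1 m)) ∈ O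
      rw [hcoord, hstab]
      exact (hφr m).1)
    (fun m ↦ by
      simp only
      rw [hcoord, hstab]
      exact (hφr m).2)
    (fun x hx ↦ by
      have : stab q x ∈ range φ.1 := hrange ▸ ⟨x, hx, rfl⟩
      obtain ⟨m, hm⟩ := this
      exact ⟨m, by simp only [hm, trunc_stab]⟩)
  refine ⟨U, hU, hu₀, q, s, hs, fun u hu ↦ ?_⟩
  obtain ⟨h1, h2⟩ := hsU u hu
  have hsu : ContMDiff (𝓡 d) (𝓡 q) ∞ fun m ↦ s (u, m) := by
    rw [← contMDiffOn_univ]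
    exact hs.comp (contMDiff_const.prodMk contMDiff_id).contMDiffOn
      fun m _ ↦ ⟨hu, mem_univ _⟩
  have hemb : IsSmoothEmb (𝓡 d) fun m ↦ s (u, m) :=
    .of_leftInverse hsu (hO.preimage (coordMap q p).continuous)
      (r := fun x ↦ r (coordMap q p x))
      (hr.comp (coordMap q p).contDiff.contMDiff.contMDiffOn fun x hx ↦ hx)
      (fun m ↦ (h2 _ (h1 m).1).1) fun m ↦ (h1 m).2
  refine ⟨⟨_, hemb, fun m ↦ (g u).2.2.1 (h1 m).1⟩, fun m ↦ rfl, ?_, fun m ↦ ⟨?_, ?_⟩⟩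
  · rw [← hgf u]
    refine Subtype.ext ?_
    rw [EmbInf.proj_coe]
    refine (range_comp (stab q) fun m ↦ s (u, m)).trans ?_
    refine congrArg (image (stab q)) (Set.ext fun x ↦ ⟨?_, fun hx ↦ ?_⟩)
    · rintro ⟨m, rfl⟩
      exact (h1 m).1
    · exact ⟨_, (h2 x hx).2⟩
  · exact (h2 _ (h1 m).1).1
  · exact (h1 m).2

/-- A local section of the projection and the resulting trivialization. -/
theorem exists_local_trivialization (φ₀ : EmbInf M) :
    ∃ V : Set (PsiInf d), IsOpen V ∧ φ₀.proj.1 ∈ V ∧ ∃ (s : PsiInf d → EmbInf M)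
      (γ : EmbInf M → Diff M), ContinuousOn s V ∧ (∀ W ∈ V, (s W).proj.1 = W) ∧
      ContinuousOn γ ((fun φ : EmbInf M ↦ φ.proj.1) ⁻¹' V) ∧
      ∀ φ : EmbInf M, φ.proj.1 ∈ V → EmbInf.act (s φ.proj.1) (γ φ) = φ := by
  classical
  -- The retraction needs a nonempty `M`. For empty `M` the claim is that the empty submanifold is
  -- an isolated point, which follows from closed graphs over a compact cube.
  rcases isEmpty_or_nonempty M with hM | hM
  · have : Subsingleton (EmbInf M) := ⟨fun φ ψ ↦ Subtype.ext (funext fun m ↦ (hM.false m).elim)⟩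
    refine ⟨{W | W.1 = ∅}, ?_, range_eq_empty _, fun _ ↦ φ₀, fun _ ↦ 1, continuousOn_const,
      fun W hW ↦ Subtype.ext ((range_eq_empty _).trans hW.symm), continuousOn_const,
      fun φ _ ↦ Subsingleton.elim _ _⟩
    refine (isPlotSpace_psiInf d).isOpen_of_eventually ?_
    rintro n f ⟨q, g, hg, hgf⟩ u hu
    obtain ⟨K, hK, hcube⟩ := exists_compact_openCube_subset q
    have h1 : ∀ v, f v ∈ {W : PsiInf d | W.1 = ∅} ↔ (g v).1 = ∅ := fun v ↦ by
      rw [← hgf]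
      exact image_eq_empty
    rw [h1] at hu
    have h2 : ∀ᶠ v in 𝓝 u, ∀ x ∈ K, (v, x) ∉ Psi.graph g := by
      refine hK.eventually_forall_of_forall_eventually fun x _ ↦ ?_
      refine hg.isClosed_graph.isOpen_compl.mem_nhds ?_
      change x ∉ (g u).1
      simp [hu]
    filter_upwards [h2] with v hv
    exact (h1 v).2 (eq_empty_iff_forall_notMem.2 fun x hx ↦ hv x (hcube ((g v).2.2.1 hx)) hx)
  · obtain ⟨_, p, ψ₀, rfl⟩ := φ₀
    set φ₀ := EmbInf.incl M p ψ₀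
    obtain ⟨O, r, hO, hr, hrψ⟩ := ψ₀.2.1.exists_retraction
    have hφ₀ : IsNormalized p O r φ₀ := fun m ↦ by
      change trunc p (stab p (ψ₀.1 m)) ∈ O ∧ r (trunc p (stab p (ψ₀.1 m))) = m
      rw [trunc_stab]
      exact hrψ m
    set V : Set (PsiInf d) := {W | ∃ φ : EmbInf M, φ.proj.1 = W ∧ IsNormalized p O r φ} with hV
    have hVo : IsOpen V := by
      refine (isPlotSpace_psiInf d).isOpen_of_eventually ?_
      rintro n f hf u ⟨φ, hφ, hφr⟩
      obtain ⟨U, hU, hu, q, s, hs, hsU⟩ := exists_normalized_family hO hr hf hφ hφr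
      filter_upwards [hU.mem_nhds hu] with v hv
      obtain ⟨ψ, -, h1, h2⟩ := hsU v hv
      exact ⟨_, h1, h2⟩
    -- The choice is forced by `IsNormalized.unique`, so it agrees with the smooth families found
    -- along plots.
    set s : PsiInf d → EmbInf M := fun W ↦ if h : W ∈ V then h.choose else φ₀ with hs
    have hsV : ∀ W ∈ V, (s W).proj.1 = W ∧ IsNormalized p O r (s W) := fun W hW ↦ by
      simp only [hs, dif_pos hW]
      exact hW.choose_spec
    have hγ : ∀ φ : EmbInf M, ∃ g : Diff M, φ.proj.1 ∈ V → EmbInf.act (s φ.proj.1) g = φ := by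
      intro φ
      by_cases hφ : φ.proj.1 ∈ V
      · obtain ⟨g, hg⟩ := EmbInf.exists_act_eq (φ := φ) (φ' := s φ.proj.1)
          (Subtype.ext (hsV _ hφ).1.symm)
        exact ⟨g, fun _ ↦ hg.symm⟩
      · exact ⟨1, fun h ↦ absurd h hφ⟩
    choose γ hγ using hγ
    -- Applying `r ∘ trunc p` to `φ m = s (φ(M)) (γ φ m)` gives `γ φ = r ∘ trunc p ∘ φ`, so the
    -- chosen diffeomorphism depends smoothly on `φ`.
    have hγr : ∀ φ : EmbInf M, φ.proj.1 ∈ V → ∀ m, trunc p (φ.1 m) ∈ O ∧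
        (γ φ).toDiffeo m = r (trunc p (φ.1 m)) := by
      intro φ hφ m
      have h1 : φ.1 m = (s φ.proj.1).1 ((γ φ).toDiffeo m) :=
        congrFun (congrArg Subtype.val (hγ φ hφ)).symm m
      have h2 := (hsV _ hφ).2 ((γ φ).toDiffeo m)
      rw [← h1] at h2
      exact ⟨h2.1, h2.2.symm⟩
    refine ⟨V, hVo, ⟨φ₀, rfl, hφ₀⟩, s, γ, ?_, fun W hW ↦ (hsV W hW).1, ?_, hγ⟩
    · refine (isPlotSpace_psiInf d).continuousOn hVo fun n f hf u hu ↦ ?_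
      obtain ⟨φ, hφ, hφr⟩ := hu
      obtain ⟨U, hU, hu, q, σ, hσ, hσU⟩ := exists_normalized_family hO hr hf hφ hφr
      refine (isPlotSpace_embInf M).continuousAt (hU.mem_nhds hu) fun κ hκ hκU ↦ ?_
      choose ψ hψσ hψf hψr using fun v ↦ hσU (κ v) (hκU v)
      refine ⟨q, ψ, Emb.isPlot_iff.2 ?_, fun v ↦ ?_⟩
      · have h1 : ContMDiff ((𝓡 n).prod (𝓡 d)) (𝓡 q) ∞ fun z : Euc n × M ↦ σ (κ z.1, z.2) := by
          rw [← contMDiffOn_univ]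
          exact hσ.comp ((hκ.contMDiff.comp contMDiff_fst).prodMk contMDiff_snd).contMDiffOn
            fun z _ ↦ ⟨hκU _, mem_univ _⟩
        exact h1.congr fun z ↦ hψσ z.1 z.2
      · have hfV : f (κ v) ∈ V := ⟨_, hψf v, hψr v⟩
        exact (hψr v).unique (hsV _ hfV).2 ((hψf v).trans (hsV _ hfV).1.symm)
    · refine (isPlotSpace_embInf M).continuousOn (hVo.preimage continuous_coe_proj)
        fun n f hf u hu ↦ ?_
      have hfc := (isPlotSpace_embInf M).continuous_plot hf
      refine (isPlotSpace_diff M).continuousAt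
        (((hVo.preimage continuous_coe_proj).preimage hfc).mem_nhds hu) fun κ hκ hκU ↦ ?_
      obtain ⟨q, g, hg, hgf⟩ := hf
      have hval : ∀ v m, trunc p ((f (κ v)).1 m) = coordMap q p ((g (κ v)).1 m) := fun v m ↦ by
        rw [← hgf]
        rfl
      have h1 : ContMDiff ((𝓡 n).prod (𝓡 d)) (𝓡 d) ∞
          fun z : Euc n × M ↦ ((γ ∘ f ∘ κ) z.1).toDiffeo z.2 := by
        have h2 : ContMDiff ((𝓡 n).prod (𝓡 d)) (𝓡 p) ∞
            fun z : Euc n × M ↦ coordMap q p ((g (κ z.1)).1 z.2) :=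
          (coordMap q p).contDiff.contMDiff.comp ((Emb.isPlot_iff.1 hg).comp
            ((hκ.contMDiff.comp contMDiff_fst).prodMk contMDiff_snd))
        rw [← contMDiffOn_univ] at h2 ⊢
        refine (hr.comp h2 fun z _ ↦ ?_).congr fun z _ ↦ ?_
        · change coordMap q p ((g (κ z.1)).1 z.2) ∈ O
          rw [← hval]
          exact (hγr _ (hκU z.1) z.2).1
        · change (γ (f (κ z.1))).toDiffeo z.2 = r (coordMap q p ((g (κ z.1)).1 z.2))
          rw [← hval]
          exact (hγr _ (hκU z.1) z.2).2
      refine ⟨h1, ?_⟩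
      -- A plot of `Diff M` also requires the inverses to form a smooth family.
      have h3 := contMDiffOn_symm_family (U := univ) isOpen_univ
        (g := fun z : Euc n × M ↦ ((γ ∘ f ∘ κ) z.1).toDiffeo z.2)
        (h := fun z : Euc n × M ↦ ((γ ∘ f ∘ κ) z.1).toDiffeo.symm z.2) h1.contMDiffOn
        (fun u _ ↦ ((γ ∘ f ∘ κ) u).toDiffeo.symm.contMDiff)
        (fun u _ m ↦ ((γ ∘ f ∘ κ) u).toDiffeo.apply_symm_apply m)
        (fun u _ m ↦ ((γ ∘ f ∘ κ) u).toDiffeo.symm_apply_apply m)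
      rwa [univ_prod_univ, contMDiffOn_univ] at h3

/-- Every submanifold over which a local section exists is an image of `M`. -/
theorem isOpen_psiInfOf (M : CompactManifold d) :
    IsOpen {W : PsiInf d | ∃ (p : ℕ) (V : Psi d p), PsiInf.incl d p V = W ∧ IsDiffeomorphicTo M V.1} := by
  rw [isOpen_iff_mem_nhds]
  intro W hW
  obtain ⟨φ, hφ⟩ := EmbInf.exists_proj_eq (⟨W, hW⟩ : PsiInfOf M)
  obtain ⟨V, hV, hφV, s, γ, -, hs, -⟩ := exists_local_trivialization φ
  rw [hφ] at hφV
  filter_upwards [hV.mem_nhds hφV] with W' hW'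
  rw [← hs W' hW']
  exact (s W').proj.2

/-- The trivialization is `e ↦ (π e, γ e)` with inverse `(W, g) ↦ s W · g`; its equivariance and one
of the inverse laws rest on the freeness of the action. -/
theorem isPrincipalBundle_proj (M : CompactManifold d) :
    IsPrincipalBundle (EmbInf.act (M := M)) EmbInf.proj where
  group := isDeltaGroup_diff M
  deltaGenerated_total := (isPlotSpace_embInf M).deltaGeneratedSpace
  deltaGenerated_base := by
    have := (isPlotSpace_psiInf d).deltaGeneratedSpace
    exact (isOpen_psiInfOf M).isGeneratedBy
  act_one := EmbInf.act_one
  act_mul := EmbInf.act_mul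
  continuous_act := continuous_act
  continuous_proj := continuous_proj
  proj_act := EmbInf.proj_act
  locally_trivial b := by
    obtain ⟨φ₀, rfl⟩ := EmbInf.exists_proj_eq b
    obtain ⟨V, hV, hφV, s, γ, hsc, hs, hγc, hγ⟩ := exists_local_trivialization φ₀
    set V' : Set (PsiInfOf M) := {W | W.1 ∈ V} with hV'
    have hV'o : IsOpen V' := hV.preimage continuous_subtype_val
    -- A map into a Delta-generated product is continuous once its components are, provided that its
    -- source is Delta-generated.
    have hgen : DeltaGeneratedSpace (EmbInf.proj (M := M) ⁻¹' V') := by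
      have := (isPlotSpace_embInf M).deltaGeneratedSpace
      exact (hV'o.preimage continuous_proj).isGeneratedBy
    have hsproj : ∀ W : V', (s W.1.1).proj = W.1 := fun W ↦ Subtype.ext (hs _ W.2)
    have hsc' : Continuous fun W : V' ↦ s W.1.1 :=
      hsc.comp_continuous (continuous_subtype_val.comp continuous_subtype_val) fun W ↦ W.2
    refine ⟨V', hV'o, hφV, {
      toFun := fun e ↦ Topology.WithGeneratedByTopology.equiv.symm (⟨e.1.proj, e.2⟩, γ e.1)
      invFun := fun z ↦ ⟨EmbInf.act (s z.pair.1.1.1) z.pair.2, by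
        rw [mem_preimage, EmbInf.proj_act, hsproj]
        exact z.pair.1.2⟩
      left_inv := fun e ↦ Subtype.ext (hγ e.1 e.2)
      right_inv := fun z ↦ ?_
      continuous_toFun := ?_
      continuous_invFun := ?_ }, fun e ↦ rfl, fun e e' g he ↦ ?_⟩
    · refine Topology.WithGeneratedByTopology.equiv.injective ?_
      have h1 : (EmbInf.act (s z.pair.1.1.1) z.pair.2).proj = z.pair.1.1 := by
        rw [EmbInf.proj_act, hsproj]
      refine Prod.ext (Subtype.ext h1) ?_
      have h2 := hγ (EmbInf.act (s z.pair.1.1.1) z.pair.2) (by rw [h1]; exact z.pair.1.2)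
      rw [h1] at h2
      exact EmbInf.act_injective _ h2
    · exact DeltaProd.continuous_mk
        (Continuous.subtype_mk (continuous_proj.comp continuous_subtype_val) _)
        (hγc.comp_continuous continuous_subtype_val fun e ↦ e.2)
    · refine Continuous.subtype_mk ?_ _
      have h1 := DeltaProd.continuous_mk (W := DeltaProd V' (Diff M))
        (hsc'.comp (continuous_fst.comp DeltaProd.continuous_pair))
        (continuous_snd.comp DeltaProd.continuous_pair)
      exact continuous_act.comp h1
    · change γ e'.1 = γ e.1 * g
      have h1 : e'.1.proj = e.1.proj := by rw [he, EmbInf.proj_act]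
      have h2 := hγ e'.1 e'.2
      rw [h1] at h2
      refine EmbInf.act_injective (s e.1.proj.1) ?_
      rw [h2, EmbInf.act_mul, hγ e.1 e.2, he]

theorem IsDiffeomorphicTo.congr {M' : CompactManifold d} {E : Type*} [NormedAddCommGroup E]
    [NormedSpace ℝ E] {W : Set E} (h : IsDiffeomorphicTo M W) (k : M ≃ₘ^∞⟮𝓡 d, 𝓡 d⟯ M') :
    IsDiffeomorphicTo M' W := by
  obtain ⟨e, he, her⟩ := h
  refine ⟨k.symm.toEquiv.trans e, he.comp k.symm.contMDiff, fun y ↦ ?_⟩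
  obtain ⟨O, r, hO, hy, hr, hre⟩ := her y
  exact ⟨O, k ∘ r, hO, hy, k.contMDiff.comp_contMDiffOn hr, fun z hz ↦ congrArg k (hre z hz)⟩

/-- `ψ_d(D^∞)` is the topological sum of the spaces of submanifolds of given diffeomorphism type. -/
theorem isHomeomorph_sigma (d : ℕ) :
    IsHomeomorph fun x : Σ q : DiffeoType d, PsiInfOf q.out ↦ (x.2.1 : PsiInf d) where
  continuous := continuous_sigma fun q ↦ continuous_subtype_val
  isOpenMap := isOpenMap_sigma.2 fun q ↦ (isOpen_psiInfOf q.out).isOpenMap_subtype_val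
  bijective := by
    constructor
    · rintro ⟨q, W⟩ ⟨q', W'⟩ h
      have h' : W.1 = W'.1 := h
      obtain ⟨φ, rfl⟩ := EmbInf.exists_proj_eq W
      obtain ⟨φ', rfl⟩ := EmbInf.exists_proj_eq W'
      -- A submanifold in two strata is parametrized by both representatives, which makes them
      -- diffeomorphic.
      obtain ⟨k, -⟩ := φ.exists_diffeomorph φ' (congrArg Subtype.val h')
      obtain rfl : q = q' := Quotient.out_equiv_out.1 ⟨k⟩
      rw [Subtype.ext h']
    · rintro ⟨_, p, V, rfl⟩
      obtain ⟨M, φ, rfl⟩ := exists_emb_image_eq V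
      obtain ⟨k⟩ : Nonempty (M ≃ₘ^∞⟮𝓡 d, 𝓡 d⟯ (⟦M⟧ : DiffeoType d).out) :=
        Setoid.symm (Quotient.mk_out M)
      exact ⟨⟨⟦M⟧, ⟨PsiInf.incl d p φ.image, p, φ.image, rfl,
        φ.2.1.isDiffeomorphicTo_range.congr k⟩⟩, rfl⟩

end Bundle

end SubmanifoldSpace

end

theorem mainTheorem9 (d : ℕ) :
    IsHomeomorph (fun x : (Σ q : SubmanifoldSpace.DiffeoType d,
      SubmanifoldSpace.PsiInfOf q.out) ↦ (x.2.1 : SubmanifoldSpace.PsiInf d)) ∧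
    ∀ M : SubmanifoldSpace.CompactManifold d,
      (∃ π : SubmanifoldSpace.EmbInf M → SubmanifoldSpace.PsiInfOf M,
        (∀ φ, (π φ).1.1 = Set.range φ.1) ∧
        SubmanifoldSpace.IsPrincipalBundle SubmanifoldSpace.EmbInf.act π) ∧
      ContractibleSpace (SubmanifoldSpace.EmbInf M) ∧
      SubmanifoldSpace.IsClassifyingSpace (SubmanifoldSpace.Diff M)
        (SubmanifoldSpace.PsiInfOf M) := by
  refine ⟨SubmanifoldSpace.isHomeomorph_sigma d, fun M ↦ ?_⟩
  have hb := SubmanifoldSpace.isPrincipalBundle_proj M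
  have hc := SubmanifoldSpace.contractibleSpace_embInf M
  exact ⟨⟨SubmanifoldSpace.EmbInf.proj, SubmanifoldSpace.EmbInf.proj_coe, hb⟩, hc,
    ⟨_, _, _, _, hb, hc⟩⟩
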